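/- Let $M$ be a smooth $4$-manifold with an $\mathrm{SU}(2)$-structure, i.e. a triple of smooth $2$-forms $\omega_1,\omega_2,\omega_3$ which at each point can be written in a suitable coframe $dx_1,\dots,dx_4$ as $\omega_1=dx_{12}+dx_{34}$, $\omega_2=dx_{13}+dx_{42}$, $\omega_3=dx_{14}+dx_{23}$. Let $g$ and $J_1,J_2,J_3$ be the induced Riemannian metric and almost complex structures, $\omega_i(\cdot,\cdot)=g(J_i\cdot,\cdot)$ (so $J_1J_2=J_3$ on vectors), and put $J_i(\alpha)(X)=\alpha(J_iX)$ for $1$-forms $\alpha$. The inner product of $k$-forms is $g(\alpha,\beta)=\frac1{k!}g^{i_1j_1}\cdots g^{i_kj_k}\alpha_{i_1\dots i_k}\beta_{j_1\dots j_k}$. Let $\nabla$ be the Levi-Civita connection of $g$, let $a_1,a_2,a_3$ be the torsion $1$-forms, $a_i(X)=\frac12 g(\nabla_X\omega_j,\omega_k)$ for $(i,j,k)$ a cyclic permutation of $(1,2,3)$, and let $\delta\alpha=-g^{bc}(\nabla_b\alpha)_c$ be the codifferential on $1$-forms. Then, at every point of $M$, \begin{align*} g(da_2,\omega_3)&=g(da_3,\omega_2)+g(a_1,J_2(a_2))+g(a_1,J_3(a_3)),\\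 g(da_3,\omega_1)&=g(da_1,\omega_3)+g(a_2,J_3(a_3))+g(a_2,J_1(a_1)),\\ g(da_1,\omega_2)&=g(da_2,\omega_1)+g(a_3,J_1(a_1))+g(a_3,J_2(a_2)). \end{align*} Thus the $12$ scalar second-order terms $\delta a_i$, $g(da_i,\omega_j)$ are determined, up to terms quadratic in the torsion, by the $9$ terms $\delta a_1,\delta a_2,\delta a_3$ and $g(da_i,\omega_j)$ with $1\le i\le j\le 3$. These $9$ terms are independent: for all real numbers $d_i$ $(1\le i\le 3)$ and $m_{ij}$ $(1\le i\le j\le 3)$ there is an $\mathrm{SU}(2)$-structure on $\mathbb{R}^4$ such that at the origin $a_1=a_2=a_3=0$, $\delta a_i=d_i$ for all $i$, and $g(da_i,\omega_j)=m_{ij}$ for all $i\le j$. -/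

import Mathlib

open scoped Manifold ContDiff

/-! # Torsion of `SU(2)`-structures on 4-manifolds

Indices `1, 2, 3` of the triple `(ω₁, ω₂, ω₃)` are the elements `0, 1, 2` of `Fin 3`; addition in
`Fin 3` is modulo `3`, so `(i, i + 1, i + 2)` runs through the cyclic permutations of `(1, 2, 3)`.
Coordinates on `ℝ⁴` are indexed by `Fin 4`. -/

namespace SU2

/-- The model space `ℝ⁴`. -/
abbrev E4 : Type := EuclideanSpace ℝ (Fin 4)

/-- The coordinate basis of `ℝ⁴`. -/
noncomputable def e (a : Fin 4) : E4 := EuclideanSpace.single a 1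

section Pointwise

variable {V : Type*} [AddCommGroup V] [Module ℝ V] [TopologicalSpace V]

/-- The value `dx_{ab}(u, v)` of the elementary `2`-form `dx_a ∧ dx_b`, where `dx` is the coframe dual
to the basis `b` of `V`. -/
noncomputable def dx (b : Module.Basis (Fin 4) ℝ V) (p q : Fin 4) (u v : V) : ℝ :=
  b.coord p u * b.coord q v - b.coord q u * b.coord p v

/-- A triple of `2`-forms on a real vector space `V` is an `SU(2)`-triple if in some coframe
`ω₁ = dx₁₂ + dx₃₄`, `ω₂ = dx₁₃ + dx₄₂`, `ω₃ = dx₁₄ + dx₂₃`. -/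
def IsSU2Triple (p : Fin 3 → V [⋀^Fin 2]→L[ℝ] ℝ) : Prop :=
  ∃ b : Module.Basis (Fin 4) ℝ V, ∀ u v : V,
    p 0 ![u, v] = dx b 0 1 u v + dx b 2 3 u v ∧
    p 1 ![u, v] = dx b 0 2 u v + dx b 3 1 u v ∧
    p 2 ![u, v] = dx b 0 3 u v + dx b 1 2 u v

end Pointwise

/-! ## The linear algebra of an `SU(2)`-triple on `ℝ⁴` -/

/-- The components `α_{i₁ … i_k} = α(∂_{i₁}, …, ∂_{i_k})` of a `k`-form. -/
noncomputable def comp {k : ℕ} (α : E4 [⋀^Fin k]→L[ℝ] ℝ) (I : Fin k → Fin 4) : ℝ :=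
  α (fun m => e (I m))

/-- The matrix `(ω_i)_{ab}`. -/
noncomputable def formMatrix (p : Fin 3 → E4 [⋀^Fin 2]→L[ℝ] ℝ) (i : Fin 3) :
    Matrix (Fin 4) (Fin 4) ℝ :=
  Matrix.of fun a b => p i ![e a, e b]

/-- The matrix of the almost complex structure `J_i`, which is determined by
`ω_j(J_i X, ·) = - ω_k(X, ·)` for `(i, j, k)` cyclic, that is
`J_iᵀ Ω_j = - Ω_k`, so that `J_i = - Ω_j⁻¹ Ω_k` as `Ω_j`, `Ω_k` are antisymmetric. With this sign
`ω_i(X, Y) = g(J_i X, Y)` with `g` positive definite, and `J_i J_j = J_k`. -/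
noncomputable def complexMatrix (p : Fin 3 → E4 [⋀^Fin 2]→L[ℝ] ℝ) (i : Fin 3) :
    Matrix (Fin 4) (Fin 4) ℝ :=
  -((formMatrix p (i + 1))⁻¹ * formMatrix p (i + 2))

/-- The almost complex structure `J_i` on vectors. -/
noncomputable def J (p : Fin 3 → E4 [⋀^Fin 2]→L[ℝ] ℝ) (i : Fin 3) : E4 →L[ℝ] E4 :=
  Matrix.toEuclideanCLM (𝕜 := ℝ) (complexMatrix p i)

/-- The action of `J_i` on `1`-forms, `(J_i α)(X) = α(J_i X)`. -/
noncomputable def Jform (p : Fin 3 → E4 [⋀^Fin 2]→L[ℝ] ℝ) (i : Fin 3)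
    (α : E4 [⋀^Fin 1]→L[ℝ] ℝ) : E4 [⋀^Fin 1]→L[ℝ] ℝ :=
  α.compContinuousLinearMap (J p i)

/-- The matrix `g_{ab}` of the metric, `g(X, Y) = ω₁(X, J₁ Y)`, equivalently
`ω₁(X, Y) = g(J₁ X, Y)`. -/
noncomputable def metric (p : Fin 3 → E4 [⋀^Fin 2]→L[ℝ] ℝ) : Matrix (Fin 4) (Fin 4) ℝ :=
  Matrix.of fun a b => p 0 ![e a, J p 0 (e b)]

/-- The inner product of (the component arrays of) two `k`-forms,
`g(α, β) = (1 / k!) g^{i₁ j₁} ⋯ g^{i_k j_k} α_{i₁ … i_k} β_{j₁ … j_k}`. -/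
noncomputable def formInner (G : Matrix (Fin 4) (Fin 4) ℝ) {k : ℕ}
    (α β : (Fin k → Fin 4) → ℝ) : ℝ :=
  (1 / (k.factorial : ℝ)) *
    ∑ I : Fin k → Fin 4, ∑ K : Fin k → Fin 4, (∏ m, G⁻¹ (I m) (K m)) * α I * β K

/-! ## Local differential geometry of a triple of `2`-forms on (an open subset of) `ℝ⁴` -/

section Local

variable (w : Fin 3 → E4 → E4 [⋀^Fin 2]→L[ℝ] ℝ)

/-- The metric `g_{ab}(y)` of the triple. -/
noncomputable def metricAt (y : E4) : Matrix (Fin 4) (Fin 4) ℝ := metric (fun i => w i y)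

/-- The Christoffel symbols `Γ^c_{ab}` of the Levi-Civita connection of `g`. -/
noncomputable def christoffel (y : E4) (c a b : Fin 4) : ℝ :=
  (1 / 2) * ∑ l : Fin 4, (metricAt w y)⁻¹ c l *
    (fderiv ℝ (fun z => metricAt w z b l) y (e a) + fderiv ℝ (fun z => metricAt w z a l) y (e b)
      - fderiv ℝ (fun z => metricAt w z a b) y (e l))

/-- The components `(∇_a β)_{i₁ … i_k}` of the Levi-Civita covariant derivative of a `k`-form,
`∂_a β_{i₁ … i_k} - ∑_m Γ^c_{a i_m} β_{i₁ … c … i_k}`. -/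
noncomputable def covDeriv {k : ℕ} (β : E4 → E4 [⋀^Fin k]→L[ℝ] ℝ) (y : E4) (a : Fin 4)
    (I : Fin k → Fin 4) : ℝ :=
  fderiv ℝ (fun z => comp (β z) I) y (e a)
    - ∑ m : Fin k, ∑ c : Fin 4, christoffel w y c a (I m) * comp (β y) (Function.update I m c)

/-- The torsion `1`-forms `a_i(X) = ½ g(∇_X ω_j, ω_k)`, `(i, j, k)` cyclic, i.e. the coefficients of
the intrinsic torsion `T = a₁ ⊗ ω₁ + a₂ ⊗ ω₂ + a₃ ⊗ ω₃`. -/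
noncomputable def torsionForm (i : Fin 3) (y : E4) : E4 [⋀^Fin 1]→L[ℝ] ℝ :=
  ContinuousAlternatingMap.ofSubsingleton ℝ E4 ℝ (0 : Fin 1)
    (∑ a : Fin 4, ((1 / 2) * formInner (metricAt w y) (covDeriv w (w (i + 1)) y a)
      (comp (w (i + 2) y))) • (EuclideanSpace.proj a : E4 →L[ℝ] ℝ))

/-- The second-order term `g(da_i, ω_j)`. -/
noncomputable def dTorsion (i j : Fin 3) (y : E4) : ℝ :=
  formInner (metricAt w y) (comp (extDeriv (torsionForm w i) y)) (comp (w j y))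

/-- The second-order term `δa_i`, where `δα = - g^{bc} (∇_b α)_c` is the codifferential. -/
noncomputable def codiffTorsion (i : Fin 3) (y : E4) : ℝ :=
  -∑ b : Fin 4, ∑ c : Fin 4,
    (metricAt w y)⁻¹ b c * covDeriv w (torsionForm w i) y b (fun _ : Fin 1 => c)

/-- The quadratic torsion term `g(a_i, J_j(a_k))`. -/
noncomputable def quadTorsion (i j k : Fin 3) (y : E4) : ℝ :=
  formInner (metricAt w y) (comp (torsionForm w i y))
    (comp (Jform (fun l => w l y) j (torsionForm w k y)))

end Local

/-! ## `SU(2)`-structures on manifolds -/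

section Manifold

variable {M : Type*} [TopologicalSpace M] [ChartedSpace E4 M]

/-- The coordinate expression in the chart `φ` of a `k`-form `β` on `M`: the pull-back of `β` by the
inverse chart (meaningful on `φ.target`). -/
noncomputable def localForm {k : ℕ} (φ : OpenPartialHomeomorph M E4)
    (β : ∀ x : M, TangentSpace (𝓡 4) x [⋀^Fin k]→L[ℝ] ℝ) (y : E4) : E4 [⋀^Fin k]→L[ℝ] ℝ :=
  (β (φ.symm y)).compContinuousLinearMap
    (mfderiv 𝓘(ℝ, E4) (𝓡 4) φ.symm y : E4 →L[ℝ] TangentSpace (𝓡 4) (φ.symm y))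

variable (M) in
/-- An `SU(2)`-structure on a smooth `4`-manifold: a triple of smooth `2`-forms that is an
`SU(2)`-triple on each tangent space. -/
structure SU2Structure where
  /-- The triple `(ω₁, ω₂, ω₃)`. -/
  form : Fin 3 → ∀ x : M, TangentSpace (𝓡 4) x [⋀^Fin 2]→L[ℝ] ℝ
  smooth : ∀ i, ∀ φ ∈ IsManifold.maximalAtlas (𝓡 4) ∞ M,
    ContDiffOn ℝ ∞ (localForm φ (form i)) φ.target
  isSU2Triple : ∀ x : M, IsSU2Triple (fun i => form i x)

/-- The coordinate expressions of `ω₁, ω₂, ω₃` in a chart. -/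
noncomputable def SU2Structure.inChart (S : SU2Structure M) (φ : OpenPartialHomeomorph M E4)
    (i : Fin 3) : E4 → E4 [⋀^Fin 2]→L[ℝ] ℝ :=
  localForm φ (S.form i)

end Manifold

end SU2

/-! Write `(i, j, k)` for a cyclic permutation of the indices. The relations are the content of
`d²ω_i = 0`, in three steps.

Pointwise, the triple satisfies the Clifford relation `Ω_i g⁻¹ Ω_j + Ω_j g⁻¹ Ω_i = -2 δ_ij g`
(`formMatrix_anticomm`). Since `∇g = 0`, its covariant derivative is a homogeneous linear system for
the `∇_a ω_i` (`covDerivMatrix_linearized`). Anti-self-dual forms commute with the quaternions, so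
this system forces each `∇_a ω_i` into the span of the triple, with skew coefficients
(`eq_of_linearized`). These coefficients are the torsion forms: `∇ω_i = a_k ⊗ ω_j - a_j ⊗ ω_k`
(`covDerivMatrix_eq`).

The connection is torsion-free, so antisymmetrising gives `dω_i = a_k ∧ ω_j - a_j ∧ ω_k`
(`structure_eq`). Applying `d` and substituting `dω_j`, `dω_k` leaves `da_j ∧ ω_k = da_k ∧ ω_j + a_i
∧ a_j ∧ ω_j + a_i ∧ a_k ∧ ω_k` (`wedge_dTorsion`).

Finally the `ω_j` are self-dual, so wedging with `ω_j` is the inner product with `ω_j` times the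
volume form (`wedge_formMatrix`), and `g(u ∧ v, ω_j) = g(u, J_j v)` (`inner₂_vecMulVec`).

For independence, the coframe `dx_0, dx_1 + q_0 dx_0, dx_2 + q_1 dx_0, dx_3 + q_2 dx_0` with
quadratic polynomials `q_k` gives a triple that is standard to first order at the origin. The
torsion vanishes there, and its first derivatives are linear in the Hessians of the `q_k`. They are
found without computing the connection, because the structure equations determine the `a_i` from the
`dω_i` (`torsion_eq_of_structure_eq`). It remains to solve a linear system for the Hessians
(`realizingCoeff`). -/

namespace SU2

open Matrix Topology

/-! ### Linear algebra of `SU(2)`-triples in an adapted coframe -/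

/-- The matrices of the standard triple `dx₁₂ + dx₃₄`, `dx₁₃ + dx₄₂`, `dx₁₄ + dx₂₃`. -/
def stdMatrix : Fin 3 → Matrix (Fin 4) (Fin 4) ℝ :=
  ![!![0, 1, 0, 0; -1, 0, 0, 0; 0, 0, 0, 1; 0, 0, -1, 0],
    !![0, 0, 1, 0; 0, 0, 0, -1; -1, 0, 0, 0; 0, 1, 0, 0],
    !![0, 0, 0, 1; 0, 0, 1, 0; 0, -1, 0, 0; -1, 0, 0, 0]]

theorem stdMatrix_mul_self (i : Fin 3) : stdMatrix i * stdMatrix i = -1 := by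
  fin_cases i <;> ext a b <;> fin_cases a <;> fin_cases b <;>
    simp [stdMatrix, Matrix.mul_apply, Fin.sum_univ_four]

/-- The sign is opposite to `J_i J_j = J_k` because in the adapted frame the matrix of `J_i` is
minus that of `ω_i`. -/
theorem stdMatrix_mul_succ (i : Fin 3) :
    stdMatrix i * stdMatrix (i + 1) = -stdMatrix (i + 2) := by
  fin_cases i <;> ext a b <;> fin_cases a <;> fin_cases b <;>
    simp [stdMatrix, Matrix.mul_apply, Fin.sum_univ_four]

theorem stdMatrix_succ_mul (i : Fin 3) :
    stdMatrix (i + 1) * stdMatrix i = stdMatrix (i + 2) := by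
  fin_cases i <;> ext a b <;> fin_cases a <;> fin_cases b <;>
    simp [stdMatrix, Matrix.mul_apply, Fin.sum_univ_four]

theorem stdMatrix_transpose (i : Fin 3) : (stdMatrix i)ᵀ = -stdMatrix i := by
  fin_cases i <;> ext a b <;> fin_cases a <;> fin_cases b <;> simp [stdMatrix]

/-- `Q` is the matrix of a coframe that puts the triple `p` into standard form. -/
structure IsCoframe (p : Fin 3 → E4 [⋀^Fin 2]→L[ℝ] ℝ) (Q : Matrix (Fin 4) (Fin 4) ℝ) : Prop where
  isUnit_det : IsUnit Q.det
  formMatrix_eq : ∀ i, formMatrix p i = Qᵀ * stdMatrix i * Q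

theorem IsSU2Triple.exists_isCoframe {p : Fin 3 → E4 [⋀^Fin 2]→L[ℝ] ℝ} (hp : IsSU2Triple p) :
    ∃ Q, IsCoframe p Q := by
  obtain ⟨b, hb⟩ := hp
  let s : Module.Basis (Fin 4) ℝ E4 := (EuclideanSpace.basisFun (Fin 4) ℝ).toBasis
  have hs : ∀ a, s a = e a := fun a => by simp [s, e]
  refine ⟨b.toMatrix s, ?_, fun i => ?_⟩
  · rw [← Module.Basis.det_apply]
    exact b.isUnit_det s
  · have h : ∀ a c, b.coord a (e c) = b.toMatrix s a c := fun a c => by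
      simp [Module.Basis.toMatrix_apply, hs]
    ext a c
    obtain ⟨h0, h1, h2⟩ := hb (e a) (e c)
    simp only [dx, h] at h0 h1 h2
    fin_cases i
    · simp [formMatrix, h0, stdMatrix, Matrix.mul_apply, Fin.sum_univ_four]
      ring
    · simp [formMatrix, h1, stdMatrix, Matrix.mul_apply, Fin.sum_univ_four]
      ring
    · simp [formMatrix, h2, stdMatrix, Matrix.mul_apply, Fin.sum_univ_four]
      ring

/-- The coefficient of `α ∧ β` on the volume form of `ℝ⁴`, for two `2`-forms. -/
def wedge (X Y : Matrix (Fin 4) (Fin 4) ℝ) : ℝ :=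
  X 0 1 * Y 2 3 - X 0 2 * Y 1 3 + X 0 3 * Y 1 2 + X 1 2 * Y 0 3 - X 1 3 * Y 0 2 + X 2 3 * Y 0 1

/-- The inner product of two `2`-forms, in terms of their matrices. -/
noncomputable def inner₂ (G X Y : Matrix (Fin 4) (Fin 4) ℝ) : ℝ :=
  1 / 2 * (Xᵀ * G⁻¹ * Y * G⁻¹ᵀ).trace

theorem formInner_two (G : Matrix (Fin 4) (Fin 4) ℝ) {α β : (Fin 2 → Fin 4) → ℝ}
    {X Y : Matrix (Fin 4) (Fin 4) ℝ} (hα : ∀ I, α I = X (I 0) (I 1))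
    (hβ : ∀ I, β I = Y (I 0) (I 1)) : formInner G α β = inner₂ G X Y := by
  unfold formInner inner₂
  simp only [hα, hβ, ← (finTwoArrowEquiv (Fin 4)).symm.sum_comp, Fintype.sum_prod_type]
  simp only [Nat.factorial_two, Nat.cast_ofNat, Fin.prod_univ_two, finTwoArrowEquiv_symm_apply,
    Matrix.cons_val_zero, Matrix.cons_val_one]
  congr 1
  simp only [Matrix.trace, Matrix.diag, Matrix.mul_apply, Matrix.transpose_apply, Finset.sum_mul]
  rw [Finset.sum_comm]
  refine Finset.sum_congr rfl fun b _ => ?_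
  calc _ = ∑ c, ∑ a, ∑ d, G⁻¹ a c * G⁻¹ b d * X a b * Y c d := Finset.sum_comm
    _ = ∑ c, ∑ d, ∑ a, G⁻¹ a c * G⁻¹ b d * X a b * Y c d :=
        Finset.sum_congr rfl fun _ _ => Finset.sum_comm
    _ = _ := by
        rw [Finset.sum_comm]
        refine Finset.sum_congr rfl fun d _ => Finset.sum_congr rfl fun c _ =>
          Finset.sum_congr rfl fun a _ => by ring

theorem formInner_one (G : Matrix (Fin 4) (Fin 4) ℝ) {α β : (Fin 1 → Fin 4) → ℝ}
    {u v : Fin 4 → ℝ} (hα : ∀ I, α I = u (I 0)) (hβ : ∀ I, β I = v (I 0)) :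
    formInner G α β = u ⬝ᵥ (G⁻¹ *ᵥ v) := by
  unfold formInner
  simp only [hα, hβ, ← (Equiv.funUnique (Fin 1) (Fin 4)).symm.sum_comp]
  simp [dotProduct, Matrix.mulVec, Finset.mul_sum]
  refine Finset.sum_congr rfl fun a _ => Finset.sum_congr rfl fun c _ => by ring

set_option maxHeartbeats 1000000 in
/-- Tensors that satisfy the linearised quaternion relations lie in the span of the standard
triple, with a skew-symmetric matrix of coefficients. -/
theorem eq_of_linearized_quaternion {X : Fin 3 → Matrix (Fin 4) (Fin 4) ℝ}
    (hX : ∀ i, (X i)ᵀ = -X i)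
    (h : ∀ i j, X i * stdMatrix j + stdMatrix i * X j + (X j * stdMatrix i + stdMatrix j * X i) = 0)
    (i : Fin 3) :
    X i = (1 / 4 * ((X i)ᵀ * stdMatrix (i + 1)).trace) • stdMatrix (i + 1)
      - (1 / 4 * ((X (i + 2))ᵀ * stdMatrix i).trace) • stdMatrix (i + 2) := by
  have hs : ∀ i a b, X i b a = -X i a b := fun i a b => congrFun (congrFun (hX i) a) b
  have hd : ∀ i a, X i a a = 0 := fun i a => by linarith [hs i a a]
  -- Anticommuting with `stdMatrix i` removes the anti-self-dual part of `X i`, which would commute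
  -- with it, and the component along `stdMatrix i` itself.
  have e1 : ∀ a b, (X i * stdMatrix i + stdMatrix i * X i) a b = 0 := fun a b => by
    have := congrFun (congrFun (h i i) a) b
    simp only [Matrix.add_apply, Matrix.zero_apply] at this ⊢
    linarith
  -- The mixed relation makes the remaining coefficients skew: that of `stdMatrix (i + 2)` in `X i`
  -- is minus that of `stdMatrix i` in `X (i + 2)`. Its diagonal entries suffice for this.
  have e2 := congrFun (congrFun (h i (i + 2)) 0) 0
  have e3 := congrFun (congrFun (h i (i + 2)) 1) 1
  have e4 := congrFun (congrFun (h i (i + 2)) 2) 2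
  have a1 := e1 0 0
  have a2 := e1 0 1
  have a3 := e1 0 2
  have a4 := e1 0 3
  have a5 := e1 1 1
  have a6 := e1 1 2
  have a7 := e1 1 3
  have a8 := e1 2 2
  have a9 := e1 2 3
  have a0 := e1 3 3
  clear h e1 hX
  have s1 := fun i => hs i 0 1
  have s2 := fun i => hs i 0 2
  have s3 := fun i => hs i 0 3
  have s4 := fun i => hs i 1 2
  have s5 := fun i => hs i 1 3
  have s6 := fun i => hs i 2 3
  clear hs
  fin_cases i <;>
  simp [stdMatrix, Matrix.mul_apply, Matrix.vecMul, dotProduct, Fin.sum_univ_four, s1, s2, s3, s4, s5, s6, hd]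
    at a1 a2 a3 a4 a5 a6 a7 a8 a9 a0 e2 e3 e4 <;>
  ext a b <;> fin_cases a <;> fin_cases b <;>
  simp [stdMatrix, Matrix.mul_apply, Fin.sum_univ_four, Matrix.trace, s1, s2, s3, s4, s5, s6, hd]
    <;> linarith

theorem apply_two (α : E4 [⋀^Fin 2]→L[ℝ] ℝ) (u v : E4) :
    α ![u, v] = ∑ a, ∑ b, u a * v b * α ![e a, e b] := by
  have hu : ∀ u : E4, u = ∑ a, u a • e a := fun u => by
    ext b
    simp [e, Pi.single_apply]
  have h := α.toMultilinearMap.map_sum (fun i a => ![u a, v a] i • e a)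
  have h0 : (fun i => ∑ a, ![u a, v a] i • e a) = ![u, v] := by
    funext i
    fin_cases i
    · exact (hu u).symm
    · exact (hu v).symm
  rw [h0, ← (finTwoArrowEquiv (Fin 4)).symm.sum_comp, Fintype.sum_prod_type] at h
  refine h.trans (Finset.sum_congr rfl fun a _ => Finset.sum_congr rfl fun b _ => ?_)
  refine (α.toMultilinearMap.map_smul_univ (fun i => ![u (![a, b] i), v (![a, b] i)] i)
    (fun i => e (![a, b] i))).trans ?_
  have he : (fun i => e (![a, b] i)) = ![e a, e b] := by
    funext i
    fin_cases i <;> rfl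
  rw [he, Fin.prod_univ_two, smul_eq_mul]
  rfl

theorem wedge_stdMatrix {X : Matrix (Fin 4) (Fin 4) ℝ} (hX : Xᵀ = -X) (i : Fin 3) :
    wedge X (stdMatrix i) = 1 / 2 * (Xᵀ * stdMatrix i).trace := by
  have hs : ∀ a b, X b a = -X a b := fun a b => congrFun (congrFun hX a) b
  fin_cases i <;>
    simp [wedge, stdMatrix, Matrix.trace, Matrix.mul_apply, Fin.sum_univ_four, hs 0 1, hs 0 2,
      hs 0 3, hs 1 2, hs 1 3, hs 2 3] <;> ring

/-- In the coframe `ω_i ∧ ω_i` is twice the volume form, and pulling back by `Q` multiplies volume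
by `Q.det`. -/
theorem wedge_conj_self (Q : Matrix (Fin 4) (Fin 4) ℝ) (i : Fin 3) :
    wedge (Qᵀ * stdMatrix i * Q) (Qᵀ * stdMatrix i * Q) = 2 * Q.det := by
  fin_cases i <;>
    simp [wedge, stdMatrix, Matrix.mul_apply, Matrix.det_succ_row_zero, Fin.sum_univ_succ, Fin.succAbove] <;> ring

/-- This is the Pfaffian adjugate identity: the second factor is the dual matrix of `X`, and `1 / 2
* wedge X X` is the Pfaffian. It expresses the inverse of a nondegenerate `2`-form through its dual.
-/
theorem mul_dual_eq {X : Matrix (Fin 4) (Fin 4) ℝ} (hX : Xᵀ = -X) :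
    X * !![0, X 2 3, -X 1 3, X 1 2; -X 2 3, 0, X 0 3, -X 0 2; X 1 3, -X 0 3, 0, X 0 1;
      -X 1 2, X 0 2, -X 0 1, 0] = -(1 / 2 * wedge X X) • 1 := by
  have hs : ∀ a b, X b a = -X a b := fun a b => congrFun (congrFun hX a) b
  have hd : ∀ a, X a a = 0 := fun a => by linarith [hs a a]
  ext a b
  fin_cases a <;> fin_cases b <;>
    simp [wedge, Matrix.mul_apply, Fin.sum_univ_four, hs 0 1, hs 0 2,
      hs 0 3, hs 1 2, hs 1 3, hs 2 3, hd] <;> ring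

namespace IsCoframe

variable {p : Fin 3 → E4 [⋀^Fin 2]→L[ℝ] ℝ} {Q : Matrix (Fin 4) (Fin 4) ℝ}

theorem complexMatrix_eq (h : IsCoframe p Q) (i : Fin 3) :
    complexMatrix p i = -(Q⁻¹ * stdMatrix i * Q) := by
  have hQ := Matrix.nonsing_inv_mul Q h.isUnit_det
  have hQT : Qᵀ * Q⁻¹ᵀ = 1 := by rw [← Matrix.transpose_mul, hQ, Matrix.transpose_one]
  have hQ' := Matrix.mul_nonsing_inv Q h.isUnit_det
  have hQT' : Q⁻¹ᵀ * Qᵀ = 1 := by rw [← Matrix.transpose_mul, hQ', Matrix.transpose_one]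
  have h1 : (formMatrix p (i + 1))⁻¹ = -(Q⁻¹ * stdMatrix (i + 1) * Q⁻¹ᵀ) := by
    refine Matrix.inv_eq_right_inv ?_
    rw [h.formMatrix_eq]
    calc _ = -(Qᵀ * stdMatrix (i + 1) * (Q * Q⁻¹) * stdMatrix (i + 1) * Q⁻¹ᵀ) := by noncomm_ring
      _ = -(Qᵀ * (stdMatrix (i + 1) * stdMatrix (i + 1)) * Q⁻¹ᵀ) := by rw [hQ']; noncomm_ring
      _ = 1 := by rw [stdMatrix_mul_self]; simp [hQT]
  have h2 : stdMatrix (i + 1) * stdMatrix (i + 2) = -stdMatrix i := by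
    have := stdMatrix_mul_succ (i + 1)
    rwa [add_assoc, add_assoc, show (1 + 1 : Fin 3) = 2 from rfl,
      show (1 + 2 : Fin 3) = 0 from rfl, add_zero] at this
  rw [complexMatrix, h1, h.formMatrix_eq]
  calc _ = Q⁻¹ * stdMatrix (i + 1) * (Q⁻¹ᵀ * Qᵀ) * stdMatrix (i + 2) * Q := by noncomm_ring
    _ = Q⁻¹ * (stdMatrix (i + 1) * stdMatrix (i + 2)) * Q := by rw [hQT']; noncomm_ring
    _ = _ := by rw [h2]; noncomm_ring

theorem metric_eq_mul : metric p = formMatrix p 0 * complexMatrix p 0 := by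
  ext a b
  have h : ∀ c, J p 0 (e b) c = complexMatrix p 0 c b := fun c => by
    simp [J, e, Matrix.ofLp_toEuclideanCLM]
  have he : ∀ c, e a c = if c = a then 1 else 0 := fun c => by
    simp [e]
  rw [metric, Matrix.of_apply, apply_two]
  simp only [h, he, Matrix.mul_apply, formMatrix, Matrix.of_apply]
  simp [mul_comm]

theorem metric_eq (h : IsCoframe p Q) : metric p = Qᵀ * Q := by
  have hQ' := Matrix.mul_nonsing_inv Q h.isUnit_det
  rw [metric_eq_mul, h.complexMatrix_eq, h.formMatrix_eq]
  calc _ = -(Qᵀ * stdMatrix 0 * (Q * Q⁻¹) * stdMatrix 0 * Q) := by noncomm_ring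
    _ = -(Qᵀ * (stdMatrix 0 * stdMatrix 0) * Q) := by rw [hQ']; noncomm_ring
    _ = _ := by rw [stdMatrix_mul_self]; noncomm_ring

theorem metric_transpose (h : IsCoframe p Q) : (metric p)ᵀ = metric p := by
  rw [h.metric_eq, Matrix.transpose_mul, Matrix.transpose_transpose]

theorem inv_metric (h : IsCoframe p Q) : (metric p)⁻¹ = Q⁻¹ * Q⁻¹ᵀ := by
  rw [h.metric_eq, Matrix.mul_inv_rev, Matrix.transpose_nonsing_inv]

theorem inv_metric_transpose (h : IsCoframe p Q) : (metric p)⁻¹ᵀ = (metric p)⁻¹ := by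
  rw [Matrix.transpose_nonsing_inv, h.metric_transpose]

theorem isUnit_det_metric (h : IsCoframe p Q) : IsUnit (metric p).det := by
  rw [h.metric_eq, Matrix.det_mul, Matrix.det_transpose]
  exact h.isUnit_det.mul h.isUnit_det

theorem formMatrix_transpose (h : IsCoframe p Q) (i : Fin 3) :
    (formMatrix p i)ᵀ = -formMatrix p i := by
  rw [h.formMatrix_eq]
  simp only [Matrix.transpose_mul, Matrix.transpose_transpose, stdMatrix_transpose]
  noncomm_ring

/-- Contraction with the inverse metric of two tensors written in the coframe. -/
theorem conj_mul_inv_metric_mul_conj (h : IsCoframe p Q) (X Y : Matrix (Fin 4) (Fin 4) ℝ) :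
    (Qᵀ * X * Q) * (metric p)⁻¹ * (Qᵀ * Y * Q) = Qᵀ * (X * Y) * Q := by
  have hQ' := Matrix.mul_nonsing_inv Q h.isUnit_det
  have hQT' : Q⁻¹ᵀ * Qᵀ = 1 := by rw [← Matrix.transpose_mul, hQ', Matrix.transpose_one]
  rw [h.inv_metric]
  calc _ = Qᵀ * X * (Q * Q⁻¹) * (Q⁻¹ᵀ * Qᵀ) * Y * Q := by noncomm_ring
    _ = _ := by rw [hQ', hQT']; noncomm_ring

theorem eq_conj (h : IsCoframe p Q) (X : Matrix (Fin 4) (Fin 4) ℝ) :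
    Qᵀ * (Q⁻¹ᵀ * X * Q⁻¹) * Q = X := by
  have hQ := Matrix.nonsing_inv_mul Q h.isUnit_det
  have hQT : Qᵀ * Q⁻¹ᵀ = 1 := by rw [← Matrix.transpose_mul, hQ, Matrix.transpose_one]
  calc _ = (Qᵀ * Q⁻¹ᵀ) * X * (Q⁻¹ * Q) := by noncomm_ring
    _ = _ := by rw [hQ, hQT]; noncomm_ring

theorem conj_injective (h : IsCoframe p Q) {X Y : Matrix (Fin 4) (Fin 4) ℝ}
    (hXY : Qᵀ * X * Q = Qᵀ * Y * Q) : X = Y := by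
  have hQ' := Matrix.mul_nonsing_inv Q h.isUnit_det
  have hQT' : Q⁻¹ᵀ * Qᵀ = 1 := by rw [← Matrix.transpose_mul, hQ', Matrix.transpose_one]
  have key : ∀ Z, Q⁻¹ᵀ * (Qᵀ * Z * Q) * Q⁻¹ = Z := fun Z => by
    calc _ = (Q⁻¹ᵀ * Qᵀ) * Z * (Q * Q⁻¹) := by noncomm_ring
      _ = _ := by rw [hQ', hQT']; noncomm_ring
  rw [← key X, hXY, key]

theorem inner₂_conj (h : IsCoframe p Q) (X Y : Matrix (Fin 4) (Fin 4) ℝ) :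
    inner₂ (metric p) (Qᵀ * X * Q) (Qᵀ * Y * Q) = 1 / 2 * (Xᵀ * Y).trace := by
  have hQ := Matrix.nonsing_inv_mul Q h.isUnit_det
  have hQT : Qᵀ * Q⁻¹ᵀ = 1 := by rw [← Matrix.transpose_mul, hQ, Matrix.transpose_one]
  have hQ' := Matrix.mul_nonsing_inv Q h.isUnit_det
  rw [inner₂, h.inv_metric_transpose]
  congr 1
  calc _ = ((Qᵀ * Xᵀ * Q) * (metric p)⁻¹ * (Qᵀ * Y * Q) * (metric p)⁻¹).trace := by
        simp only [Matrix.transpose_mul, Matrix.transpose_transpose, Matrix.mul_assoc]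
    _ = (Qᵀ * (Xᵀ * Y) * (Q * Q⁻¹) * Q⁻¹ᵀ).trace := by
        rw [h.conj_mul_inv_metric_mul_conj, h.inv_metric]; congr 1; noncomm_ring
    _ = _ := by
        rw [hQ', Matrix.mul_one, Matrix.trace_mul_comm, ← Matrix.mul_assoc,
          ← Matrix.transpose_mul, hQ', Matrix.transpose_one, Matrix.one_mul]

/-- The quaternion relations in a form that involves only the triple and the metric, not the
coframe, and so can be differentiated without choosing a smooth coframe. -/
theorem formMatrix_anticomm (h : IsCoframe p Q) (i j : Fin 3) :
    formMatrix p i * (metric p)⁻¹ * formMatrix p j + formMatrix p j * (metric p)⁻¹ * formMatrix p i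
      = (if i = j then (-2 : ℝ) else 0) • metric p := by
  have key : stdMatrix i * stdMatrix j + stdMatrix j * stdMatrix i
      = (if i = j then (-2 : ℝ) else 0) • 1 := by
    have hij : j = i ∨ j = i + 1 ∨ i = j + 1 := by decide +revert
    have hne : ∀ k : Fin 3, k ≠ k + 1 := by decide
    rcases hij with rfl | rfl | rfl
    · rw [stdMatrix_mul_self, if_pos rfl, neg_smul, two_smul]
      abel
    · rw [stdMatrix_mul_succ, stdMatrix_succ_mul, if_neg (hne i)]
      simp
    · rw [stdMatrix_mul_succ, stdMatrix_succ_mul, if_neg (hne j).symm]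
      simp
  rw [h.formMatrix_eq, h.formMatrix_eq, h.conj_mul_inv_metric_mul_conj,
    h.conj_mul_inv_metric_mul_conj, ← Matrix.add_mul, ← Matrix.mul_add, key, h.metric_eq]
  simp

/-- Self-duality of `ω_i`. Its inverse matrix can be computed in two ways: by raising indices, from
`Y g⁻¹ Y = -g`, or by the Pfaffian adjugate. Comparing them shows that raising the indices of `ω_i`
gives its dual divided by `Q.det`. The sign of `Q.det` records the orientation. -/
theorem wedge_formMatrix (h : IsCoframe p Q) {X : Matrix (Fin 4) (Fin 4) ℝ} (hX : Xᵀ = -X)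
    (i : Fin 3) : wedge X (formMatrix p i) = Q.det * inner₂ (metric p) X (formMatrix p i) := by
  set Y := formMatrix p i with hY
  set H := (metric p)⁻¹ with hH
  have hYT : Yᵀ = -Y := h.formMatrix_transpose i
  have hY2 : Y * H * Y = -metric p := by
    have := h.formMatrix_anticomm i i
    rw [if_pos rfl, ← two_smul ℝ, ← hY, ← hH, neg_smul, ← smul_neg] at this
    exact smul_right_injective _ (two_ne_zero (α := ℝ)) this
  have hGH : metric p * H = 1 := Matrix.mul_nonsing_inv _ h.isUnit_det_metric
  have hinv : Y * (-(H * Y * H)) = 1 := by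
    calc _ = -((Y * H * Y) * H) := by noncomm_ring
      _ = 1 := by rw [hY2, neg_mul, neg_neg, hGH]
  have hinv' : -(H * Y * H) * Y = 1 := mul_eq_one_comm.mp hinv
  have hw : wedge Y Y = 2 * Q.det := by rw [hY, h.formMatrix_eq, wedge_conj_self]
  have hdual := mul_dual_eq hYT
  rw [hw] at hdual
  replace hdual := congrArg (fun Z => -(H * Y * H) * Z) hdual
  simp only [← Matrix.mul_assoc, hinv'] at hdual
  simp only [Matrix.one_mul, Matrix.mul_smul, Matrix.mul_one] at hdual
  have hD : H * Y * H = Q.det⁻¹ • !![0, Y 2 3, -Y 1 3, Y 1 2; -Y 2 3, 0, Y 0 3, -Y 0 2; Y 1 3, -Y 0 3, 0, Y 0 1;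
      -Y 1 2, Y 0 2, -Y 0 1, 0] := by
    rw [hdual]
    have := h.isUnit_det.ne_zero
    ext a b
    simp
    field_simp
  have hs : ∀ a b, X b a = -X a b := fun a b => congrFun (congrFun hX a) b
  have hd : ∀ a, X a a = 0 := fun a => by linarith [hs a a]
  rw [inner₂, ← hH, hH, h.inv_metric_transpose, ← hH]
  simp only [Matrix.mul_assoc] at hD ⊢
  rw [hD]
  have := h.isUnit_det.ne_zero
  simp [wedge, Matrix.trace, Matrix.mul_apply, Fin.sum_univ_four, hs 0 1, hs 0 2, hs 0 3, hs 1 2,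
    hs 1 3, hs 2 3, hd]
  field_simp
  ring

/-- Derivatives of the triple that are compatible with the metric lie in the span of the triple. -/
theorem eq_of_linearized (h : IsCoframe p Q) {C : Fin 3 → Matrix (Fin 4) (Fin 4) ℝ}
    (hC : ∀ i, (C i)ᵀ = -C i)
    (hlin : ∀ i j, C i * (metric p)⁻¹ * formMatrix p j + formMatrix p i * (metric p)⁻¹ * C j
      + (C j * (metric p)⁻¹ * formMatrix p i + formMatrix p j * (metric p)⁻¹ * C i) = 0)
    (i : Fin 3) :
    C i = (1 / 2 * inner₂ (metric p) (C i) (formMatrix p (i + 1))) • formMatrix p (i + 1)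
      - (1 / 2 * inner₂ (metric p) (C (i + 2)) (formMatrix p i)) • formMatrix p (i + 2) := by
  -- In the coframe the metric becomes the identity and the triple becomes the standard one.
  set X : Fin 3 → Matrix (Fin 4) (Fin 4) ℝ := fun i => Q⁻¹ᵀ * C i * Q⁻¹ with hXdef
  have hCX : ∀ i, C i = Qᵀ * X i * Q := fun i => (h.eq_conj (C i)).symm
  have hX : ∀ i, (X i)ᵀ = -X i := fun i => by
    simp only [hXdef, Matrix.transpose_mul, Matrix.transpose_transpose, hC]
    noncomm_ring
  have hl : ∀ i j, X i * stdMatrix j + stdMatrix i * X j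
      + (X j * stdMatrix i + stdMatrix j * X i) = 0 := fun i j => by
    have := hlin i j
    rw [hCX, hCX, h.formMatrix_eq, h.formMatrix_eq] at this
    simp only [h.conj_mul_inv_metric_mul_conj] at this
    apply h.conj_injective
    rw [Matrix.mul_zero, Matrix.zero_mul, ← this]
    noncomm_ring
  have key := eq_of_linearized_quaternion hX hl i
  rw [hCX i, hCX (i + 2), h.formMatrix_eq, h.formMatrix_eq, h.formMatrix_eq, h.inner₂_conj,
    h.inner₂_conj]
  conv_lhs => rw [key]
  simp only [Matrix.mul_sub, Matrix.sub_mul, Matrix.mul_smul, Matrix.smul_mul]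
  norm_num [← mul_assoc]

theorem inv_metric_mul_complexMatrix_transpose (h : IsCoframe p Q) (i : Fin 3) :
    (metric p)⁻¹ * (complexMatrix p i)ᵀ = (metric p)⁻¹ * formMatrix p i * (metric p)⁻¹ := by
  have hQ := Matrix.nonsing_inv_mul Q h.isUnit_det
  have hQT : Qᵀ * Q⁻¹ᵀ = 1 := by rw [← Matrix.transpose_mul, hQ, Matrix.transpose_one]
  have hQ' := Matrix.mul_nonsing_inv Q h.isUnit_det
  rw [Matrix.mul_assoc]
  congr 1
  rw [h.complexMatrix_eq, h.formMatrix_eq, h.inv_metric, Matrix.transpose_neg,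
    Matrix.transpose_mul, Matrix.transpose_mul, stdMatrix_transpose]
  calc _ = Qᵀ * stdMatrix i * 1 * Q⁻¹ᵀ := by noncomm_ring
    _ = _ := by rw [← hQ']; noncomm_ring

/-- The inner product of `u ∧ v` with `ω_i` is `g(u, J_i v)`. -/
theorem inner₂_vecMulVec (h : IsCoframe p Q) (u v : Fin 4 → ℝ) (i : Fin 3) :
    inner₂ (metric p) (vecMulVec u v - vecMulVec v u) (formMatrix p i)
      = u ⬝ᵥ ((metric p)⁻¹ *ᵥ ((complexMatrix p i)ᵀ *ᵥ v)) := by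
  set H := (metric p)⁻¹ with hH
  -- Skewness of the raised form lets the two halves of `u ∧ v` contribute equally, which cancels
  -- the factor `1 / 2` in `inner₂`.
  have hT : (H * formMatrix p i * H)ᵀ = -(H * formMatrix p i * H) := by
    simp only [Matrix.transpose_mul, hH, h.inv_metric_transpose, h.formMatrix_transpose]
    noncomm_ring
  rw [Matrix.mulVec_mulVec, h.inv_metric_mul_complexMatrix_transpose, inner₂,
    h.inv_metric_transpose, ← hH]
  generalize hK : H * formMatrix p i * H = K at hT
  have : ∀ X : Matrix (Fin 4) (Fin 4) ℝ, X * H * formMatrix p i * H = X * K := fun X => by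
    rw [← hK]; noncomm_ring
  have hs : ∀ a b, K b a = -K a b := fun a b => congrFun (congrFun hT a) b
  have hd : ∀ a, K a a = 0 := fun a => by linarith [hs a a]
  rw [this]
  simp [Matrix.trace, Matrix.mul_apply, Fin.sum_univ_four, Matrix.vecMulVec_apply, dotProduct,
    Matrix.mulVec, hs 0 1, hs 0 2, hs 0 3, hs 1 2, hs 1 3, hs 2 3, hd]
  ring

end IsCoframe

/-! ### Calculus of matrix-valued functions, entry by entry -/

/-- The entrywise partial derivative `∂_a X` of a matrix-valued function. -/
noncomputable def pderivMatrix (X : E4 → Matrix (Fin 4) (Fin 4) ℝ) (y : E4) (a : Fin 4) :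
    Matrix (Fin 4) (Fin 4) ℝ :=
  Matrix.of fun b c => fderiv ℝ (fun z => X z b c) y (e a)

/-- Entrywise differentiability of a matrix-valued function. -/
def MatrixDifferentiableAt (X : E4 → Matrix (Fin 4) (Fin 4) ℝ) (y : E4) : Prop :=
  ∀ b c, DifferentiableAt ℝ (fun z => X z b c) y

/-- Entrywise smoothness of a matrix-valued function. -/
def MatrixSmoothOn (X : E4 → Matrix (Fin 4) (Fin 4) ℝ) (U : Set E4) : Prop :=
  ∀ b c, ContDiffOn ℝ ∞ (fun z => X z b c) U

section MatrixCalculus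

variable {X Y : E4 → Matrix (Fin 4) (Fin 4) ℝ} {y : E4} {U : Set E4}

theorem MatrixSmoothOn.differentiableAt (hX : MatrixSmoothOn X U) (hU : IsOpen U) (hy : y ∈ U) :
    MatrixDifferentiableAt X y := fun b c =>
  ((hX b c).contDiffAt (hU.mem_nhds hy)).differentiableAt (by simp)

theorem MatrixSmoothOn.mul (hX : MatrixSmoothOn X U) (hY : MatrixSmoothOn Y U) :
    MatrixSmoothOn (fun z => X z * Y z) U := fun b c => by
  simp only [Matrix.mul_apply]
  exact ContDiffOn.sum fun k _ => (hX b k).mul (hY k c)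

theorem MatrixSmoothOn.neg (hX : MatrixSmoothOn X U) : MatrixSmoothOn (fun z => -X z) U :=
  fun b c => (hX b c).neg

theorem MatrixSmoothOn.congr (hX : MatrixSmoothOn X U) (h : ∀ z ∈ U, Y z = X z) :
    MatrixSmoothOn Y U := fun b c => (hX b c).congr fun z hz => by rw [h z hz]

theorem MatrixSmoothOn.det (hX : MatrixSmoothOn X U) : ContDiffOn ℝ ∞ (fun z => (X z).det) U := by
  simp only [Matrix.det_apply']
  exact ContDiffOn.sum fun σ _ => contDiffOn_const.mul (contDiffOn_prod fun i _ => hX _ _)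

theorem MatrixSmoothOn.inv (hX : MatrixSmoothOn X U) (h : ∀ z ∈ U, IsUnit (X z).det) :
    MatrixSmoothOn (fun z => (X z)⁻¹) U := fun b c => by
  simp only [Matrix.inv_def, Ring.inverse_eq_inv', Matrix.smul_apply, smul_eq_mul,
    Matrix.adjugate_apply]
  refine (hX.det.inv fun z hz => (h z hz).ne_zero).mul (MatrixSmoothOn.det fun i j => ?_)
  by_cases hi : i = c
  · subst hi
    simp only [Matrix.updateRow_self]
    exact contDiffOn_const
  · simp only [Matrix.updateRow_ne hi]
    exact hX i j

theorem MatrixDifferentiableAt.mul (hX : MatrixDifferentiableAt X y)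
    (hY : MatrixDifferentiableAt Y y) : MatrixDifferentiableAt (fun z => X z * Y z) y :=
  fun b c => by
    simp only [Matrix.mul_apply]
    exact DifferentiableAt.fun_sum fun k _ => (hX b k).mul (hY k c)

theorem pderivMatrix_mul (hX : MatrixDifferentiableAt X y) (hY : MatrixDifferentiableAt Y y)
    (a : Fin 4) : pderivMatrix (fun z => X z * Y z) y a
      = pderivMatrix X y a * Y y + X y * pderivMatrix Y y a := by
  ext b c
  simp only [pderivMatrix, Matrix.of_apply, Matrix.mul_apply, Matrix.add_apply]
  rw [fderiv_fun_sum fun k _ => (hX b k).fun_mul (hY k c), ← Finset.sum_add_distrib]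
  simp only [_root_.sum_apply]
  refine Finset.sum_congr rfl fun k _ => ?_
  rw [fderiv_fun_mul (hX b k) (hY k c)]
  simp
  ring

theorem pderivMatrix_add (hX : MatrixDifferentiableAt X y) (hY : MatrixDifferentiableAt Y y)
    (a : Fin 4) : pderivMatrix (fun z => X z + Y z) y a
      = pderivMatrix X y a + pderivMatrix Y y a := by
  ext b c
  simp only [pderivMatrix, Matrix.of_apply, Matrix.add_apply]
  rw [fderiv_fun_add (hX b c) (hY b c)]
  rfl

theorem pderivMatrix_const_smul (hX : MatrixDifferentiableAt X y) (r : ℝ) (a : Fin 4) :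
    pderivMatrix (fun z => r • X z) y a = r • pderivMatrix X y a := by
  ext b c
  simp only [pderivMatrix, Matrix.of_apply, Matrix.smul_apply]
  rw [fderiv_fun_const_smul (hX b c)]
  rfl

theorem pderivMatrix_const (M : Matrix (Fin 4) (Fin 4) ℝ) (a : Fin 4) :
    pderivMatrix (fun _ => M) y a = 0 := by
  ext b c
  simp [pderivMatrix]

theorem pderivMatrix_congr (hU : U ∈ 𝓝 y) (h : ∀ z ∈ U, X z = Y z) (a : Fin 4) :
    pderivMatrix X y a = pderivMatrix Y y a := by
  ext b c
  simp only [pderivMatrix, Matrix.of_apply]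
  rw [Filter.EventuallyEq.fderiv_eq]
  filter_upwards [hU] with z hz
  rw [h z hz]

end MatrixCalculus

/-! ### The Levi-Civita connection of the triple and the structure equations -/

/-- A smooth triple of `2`-forms on an open subset of `ℝ⁴` that is pointwise an `SU(2)`-triple. -/
structure IsLocalSU2 (w : Fin 3 → E4 → E4 [⋀^Fin 2]→L[ℝ] ℝ) (U : Set E4) : Prop where
  isOpen : IsOpen U
  smooth : ∀ i, ContDiffOn ℝ ∞ (w i) U
  isSU2Triple : ∀ y ∈ U, IsSU2Triple fun i => w i y

/-- The matrix of `ω_i` as a function on `ℝ⁴`. -/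
noncomputable def formMatrixAt (w : Fin 3 → E4 → E4 [⋀^Fin 2]→L[ℝ] ℝ) (i : Fin 3) (y : E4) :
    Matrix (Fin 4) (Fin 4) ℝ :=
  formMatrix (fun l => w l y) i

/-- The Christoffel symbols as the matrices `(Γ_a)^c_b`. -/
noncomputable def christoffelMatrix (w : Fin 3 → E4 → E4 [⋀^Fin 2]→L[ℝ] ℝ) (y : E4) (a : Fin 4) :
    Matrix (Fin 4) (Fin 4) ℝ :=
  Matrix.of fun c b => christoffel w y c a b

/-- The matrix of `∇_a ω_i`. -/
noncomputable def covDerivMatrix (w : Fin 3 → E4 → E4 [⋀^Fin 2]→L[ℝ] ℝ) (i : Fin 3) (y : E4)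
    (a : Fin 4) : Matrix (Fin 4) (Fin 4) ℝ :=
  pderivMatrix (formMatrixAt w i) y a - (christoffelMatrix w y a)ᵀ * formMatrixAt w i y
    - formMatrixAt w i y * christoffelMatrix w y a

/-- The components of the torsion form `a_i`. -/
noncomputable def torsionCoeff (w : Fin 3 → E4 → E4 [⋀^Fin 2]→L[ℝ] ℝ) (i : Fin 3) (a : Fin 4)
    (y : E4) : ℝ :=
  1 / 2 * inner₂ (metricAt w y) (covDerivMatrix w (i + 1) y a) (formMatrixAt w (i + 2) y)

theorem comp_two (α : E4 [⋀^Fin 2]→L[ℝ] ℝ) (I : Fin 2 → Fin 4) :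
    comp α I = α ![e (I 0), e (I 1)] := by
  unfold comp
  congr 1
  funext m
  fin_cases m <;> rfl

theorem covDeriv_eq_covDerivMatrix (w : Fin 3 → E4 → E4 [⋀^Fin 2]→L[ℝ] ℝ) (i : Fin 3) (y : E4)
    (a : Fin 4) (I : Fin 2 → Fin 4) :
    covDeriv w (w i) y a I = covDerivMatrix w i y a (I 0) (I 1) := by
  simp only [covDeriv, comp_two, Fin.sum_univ_two, covDerivMatrix, Matrix.sub_apply,
    Matrix.mul_apply, Matrix.transpose_apply, christoffelMatrix, Matrix.of_apply, pderivMatrix,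
    formMatrixAt, formMatrix]
  simp [Function.update_of_ne, sub_sub, mul_comm]

theorem comp_torsionForm (w : Fin 3 → E4 → E4 [⋀^Fin 2]→L[ℝ] ℝ) (i : Fin 3) (y : E4)
    (I : Fin 1 → Fin 4) : comp (torsionForm w i y) I = torsionCoeff w i (I 0) y := by
  have h : ∀ a, 1 / 2 * formInner (metricAt w y) (covDeriv w (w (i + 1)) y a)
      (comp (w (i + 2) y)) = torsionCoeff w i a y := fun a => by
    rw [torsionCoeff, formInner_two _ (covDeriv_eq_covDerivMatrix w (i + 1) y a)
      (Y := formMatrixAt w (i + 2) y) fun I => by rw [comp_two]; rfl]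
  simp only [comp, torsionForm, h]
  simp [e]

/-- As a combination of constant `1`-forms, the torsion form inherits differentiability from its
coefficients. -/
theorem torsionForm_eq (w : Fin 3 → E4 → E4 [⋀^Fin 2]→L[ℝ] ℝ) (i : Fin 3) (y : E4) :
    torsionForm w i y = ∑ a, torsionCoeff w i a y •
      ContinuousAlternatingMap.ofSubsingletonLIE (𝕜 := ℝ) (E := E4) (F := ℝ) (0 : Fin 1)
        (EuclideanSpace.proj a : E4 →L[ℝ] ℝ) := by
  have h : ∀ a, 1 / 2 * formInner (metricAt w y) (covDeriv w (w (i + 1)) y a)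
      (comp (w (i + 2) y)) = torsionCoeff w i a y := fun a => by
    rw [torsionCoeff, formInner_two _ (covDeriv_eq_covDerivMatrix w (i + 1) y a)
      (Y := formMatrixAt w (i + 2) y) fun I => by rw [comp_two]; rfl]
  simp only [torsionForm, h]
  simp only [← map_smul, ← map_sum]
  rfl

namespace IsLocalSU2

variable {w : Fin 3 → E4 → E4 [⋀^Fin 2]→L[ℝ] ℝ} {U : Set E4} {y : E4}

theorem exists_isCoframe (h : IsLocalSU2 w U) (hy : y ∈ U) : ∃ Q, IsCoframe (fun i => w i y) Q :=
  (h.isSU2Triple y hy).exists_isCoframe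

theorem smooth_formMatrixAt (h : IsLocalSU2 w U) (i : Fin 3) :
    MatrixSmoothOn (formMatrixAt w i) U := fun b c =>
  (ContinuousAlternatingMap.apply ℝ E4 ℝ ![e b, e c]).contDiff.comp_contDiffOn (h.smooth i)

theorem isUnit_det_formMatrixAt (h : IsLocalSU2 w U) (i : Fin 3) (hy : y ∈ U) :
    IsUnit (formMatrixAt w i y).det := by
  obtain ⟨Q, hQ⟩ := h.exists_isCoframe hy
  rw [formMatrixAt, hQ.formMatrix_eq, Matrix.det_mul, Matrix.det_mul, Matrix.det_transpose]
  have : IsUnit (stdMatrix i) := .of_mul_eq_one (-stdMatrix i) (by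
    rw [Matrix.mul_neg, stdMatrix_mul_self, neg_neg])
  exact (hQ.isUnit_det.mul ((Matrix.isUnit_iff_isUnit_det _).mp this)).mul hQ.isUnit_det

theorem smooth_metricAt (h : IsLocalSU2 w U) : MatrixSmoothOn (metricAt w) U := by
  refine ((h.smooth_formMatrixAt 0).mul (((h.smooth_formMatrixAt 1).inv
    fun z hz => h.isUnit_det_formMatrixAt 1 hz).mul (h.smooth_formMatrixAt 2)).neg).congr
    fun z _ => ?_
  exact IsCoframe.metric_eq_mul

theorem isUnit_det_metricAt (h : IsLocalSU2 w U) (hy : y ∈ U) : IsUnit (metricAt w y).det := by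
  obtain ⟨Q, hQ⟩ := h.exists_isCoframe hy
  exact hQ.isUnit_det_metric

theorem metricAt_transpose (h : IsLocalSU2 w U) (hy : y ∈ U) :
    (metricAt w y)ᵀ = metricAt w y := by
  obtain ⟨Q, hQ⟩ := h.exists_isCoframe hy
  exact hQ.metric_transpose

theorem smooth_inv_metricAt (h : IsLocalSU2 w U) :
    MatrixSmoothOn (fun z => (metricAt w z)⁻¹) U :=
  h.smooth_metricAt.inv fun _ hz => h.isUnit_det_metricAt hz

theorem contDiffOn_pderiv (h : IsLocalSU2 w U) {f : E4 → ℝ} (hf : ContDiffOn ℝ ∞ f U) (a : Fin 4) :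
    ContDiffOn ℝ ∞ (fun z => fderiv ℝ f z (e a)) U :=
  (hf.fderiv_of_isOpen h.isOpen (by simp)).clm_apply contDiffOn_const

theorem smooth_christoffelMatrix (h : IsLocalSU2 w U) (a : Fin 4) :
    MatrixSmoothOn (fun z => christoffelMatrix w z a) U := fun c b => by
  simp only [christoffelMatrix, Matrix.of_apply, christoffel]
  exact contDiffOn_const.mul (ContDiffOn.sum fun l _ => (h.smooth_inv_metricAt c l).mul
    (((h.contDiffOn_pderiv (h.smooth_metricAt b l) a).add
      (h.contDiffOn_pderiv (h.smooth_metricAt a l) b)).sub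
      (h.contDiffOn_pderiv (h.smooth_metricAt a b) l)))

theorem smooth_covDerivMatrix (h : IsLocalSU2 w U) (i : Fin 3) (a : Fin 4) :
    MatrixSmoothOn (fun z => covDerivMatrix w i z a) U := fun b c =>
  ((h.contDiffOn_pderiv (h.smooth_formMatrixAt i b c) a).sub
    (MatrixSmoothOn.mul (fun b c => h.smooth_christoffelMatrix a c b)
      (h.smooth_formMatrixAt i) b c)).sub
    ((h.smooth_formMatrixAt i).mul (h.smooth_christoffelMatrix a) b c)

theorem contDiffOn_torsionCoeff (h : IsLocalSU2 w U) (i : Fin 3) (a : Fin 4) :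
    ContDiffOn ℝ ∞ (torsionCoeff w i a) U := by
  unfold torsionCoeff inner₂
  have h1 : MatrixSmoothOn (fun z => (covDerivMatrix w (i + 1) z a)ᵀ) U := fun b c =>
    h.smooth_covDerivMatrix (i + 1) a c b
  have h2 : MatrixSmoothOn (fun z => (metricAt w z)⁻¹ᵀ) U := fun b c =>
    h.smooth_inv_metricAt c b
  exact contDiffOn_const.mul (contDiffOn_const.mul (ContDiffOn.sum fun b _ =>
    ((h1.mul h.smooth_inv_metricAt).mul (h.smooth_formMatrixAt (i + 2))).mul h2 b b))

theorem differentiableAt_torsionCoeff (h : IsLocalSU2 w U) (hy : y ∈ U) (i : Fin 3) (a : Fin 4) :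
    DifferentiableAt ℝ (torsionCoeff w i a) y :=
  ((h.contDiffOn_torsionCoeff i a).contDiffAt (h.isOpen.mem_nhds hy)).differentiableAt (by simp)

theorem christoffel_symm (h : IsLocalSU2 w U) (hy : y ∈ U) (c a b : Fin 4) :
    christoffel w y c a b = christoffel w y c b a := by
  have hsymm : fderiv ℝ (fun z => metricAt w z a b) y = fderiv ℝ (fun z => metricAt w z b a) y := by
    apply Filter.EventuallyEq.fderiv_eq
    filter_upwards [h.isOpen.mem_nhds hy] with z hz
    exact congrFun (congrFun (h.metricAt_transpose hz) b) a
  have hab : ∀ l, fderiv ℝ (fun z => metricAt w z a b) y (e l)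
    = fderiv ℝ (fun z => metricAt w z b a) y (e l) := fun l => by rw [hsymm]
  simp only [christoffel, hab]
  congr 1
  refine Finset.sum_congr rfl fun l _ => ?_
  ring

/-- The Levi-Civita connection is compatible with the metric. -/
theorem pderiv_metricAt (h : IsLocalSU2 w U) (hy : y ∈ U) (a : Fin 4) :
    pderivMatrix (metricAt w) y a = metricAt w y * christoffelMatrix w y a
      + (christoffelMatrix w y a)ᵀ * metricAt w y := by
  have hsymm : ∀ b c, fderiv ℝ (fun z => metricAt w z b c) y
      = fderiv ℝ (fun z => metricAt w z c b) y := fun b c => by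
    apply Filter.EventuallyEq.fderiv_eq
    filter_upwards [h.isOpen.mem_nhds hy] with z hz
    exact congrFun (congrFun (h.metricAt_transpose hz) c) b
  -- Twice the Christoffel symbol with its upper index lowered; its symmetric part in `l, b` is `∂_a
  -- g_{lb}`.
  set S : Matrix (Fin 4) (Fin 4) ℝ := Matrix.of fun l b =>
    fderiv ℝ (fun z => metricAt w z b l) y (e a) + fderiv ℝ (fun z => metricAt w z a l) y (e b)
      - fderiv ℝ (fun z => metricAt w z a b) y (e l) with hS
  have hΓ : christoffelMatrix w y a = (1 / 2 : ℝ) • ((metricAt w y)⁻¹ * S) := by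
    ext c b
    simp [christoffelMatrix, christoffel, Matrix.mul_apply, hS]
  have hGΓ : metricAt w y * christoffelMatrix w y a = (1 / 2 : ℝ) • S := by
    rw [hΓ, Matrix.mul_smul, ← Matrix.mul_assoc,
      Matrix.mul_nonsing_inv _ (h.isUnit_det_metricAt hy), Matrix.one_mul]
  have hGΓ' : (christoffelMatrix w y a)ᵀ * metricAt w y = (1 / 2 : ℝ) • Sᵀ := by
    rw [← Matrix.transpose_smul, ← hGΓ, Matrix.transpose_mul, h.metricAt_transpose hy]
  rw [hGΓ, hGΓ']
  ext b c
  simp only [pderivMatrix, Matrix.of_apply, hS, Matrix.add_apply, Matrix.smul_apply,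
    Matrix.transpose_apply, smul_eq_mul]
  rw [hsymm c b]
  ring

theorem formMatrixAt_transpose (h : IsLocalSU2 w U) (hy : y ∈ U) (i : Fin 3) :
    (formMatrixAt w i y)ᵀ = -formMatrixAt w i y := by
  obtain ⟨Q, hQ⟩ := h.exists_isCoframe hy
  exact hQ.formMatrix_transpose i

theorem pderiv_formMatrixAt_transpose (h : IsLocalSU2 w U) (hy : y ∈ U) (i : Fin 3) (a : Fin 4) :
    (pderivMatrix (formMatrixAt w i) y a)ᵀ = -pderivMatrix (formMatrixAt w i) y a := by
  ext b c
  simp only [pderivMatrix, Matrix.of_apply, Matrix.transpose_apply, Matrix.neg_apply]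
  rw [← _root_.neg_apply, ← fderiv_fun_neg]
  congr 1
  apply Filter.EventuallyEq.fderiv_eq
  filter_upwards [h.isOpen.mem_nhds hy] with z hz
  exact congrFun (congrFun (h.formMatrixAt_transpose hz i) b) c

theorem covDerivMatrix_transpose (h : IsLocalSU2 w U) (hy : y ∈ U) (i : Fin 3) (a : Fin 4) :
    (covDerivMatrix w i y a)ᵀ = -covDerivMatrix w i y a := by
  simp only [covDerivMatrix, Matrix.transpose_sub, Matrix.transpose_mul,
    h.pderiv_formMatrixAt_transpose hy, h.formMatrixAt_transpose hy, Matrix.transpose_transpose]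
  noncomm_ring

/-- Differentiating `g⁻¹ g = 1` turns `∇g = 0` into `∇g⁻¹ = 0`. -/
theorem pderiv_inv_metricAt (h : IsLocalSU2 w U) (hy : y ∈ U) (a : Fin 4) :
    pderivMatrix (fun z => (metricAt w z)⁻¹) y a
      = -(christoffelMatrix w y a * (metricAt w y)⁻¹
        + (metricAt w y)⁻¹ * (christoffelMatrix w y a)ᵀ) := by
  set H := (metricAt w y)⁻¹ with hH
  have hHG : H * metricAt w y = 1 := Matrix.nonsing_inv_mul _ (h.isUnit_det_metricAt hy)
  have hGH : metricAt w y * H = 1 := Matrix.mul_nonsing_inv _ (h.isUnit_det_metricAt hy)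
  have h1 : pderivMatrix (fun z => (metricAt w z)⁻¹ * metricAt w z) y a = 0 := by
    rw [pderivMatrix_congr (Y := fun _ => 1) (h.isOpen.mem_nhds hy)
      (fun z hz => Matrix.nonsing_inv_mul _ (h.isUnit_det_metricAt hz)), pderivMatrix_const]
  rw [pderivMatrix_mul (h.smooth_inv_metricAt.differentiableAt h.isOpen hy)
    (h.smooth_metricAt.differentiableAt h.isOpen hy), h.pderiv_metricAt hy] at h1
  set D := pderivMatrix (fun z => (metricAt w z)⁻¹) y a
  set Γ := christoffelMatrix w y a
  calc D = (D * metricAt w y) * H := by rw [Matrix.mul_assoc, hGH, Matrix.mul_one]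
    _ = (-(H * (metricAt w y * Γ + Γᵀ * metricAt w y))) * H := by
        rw [eq_neg_of_add_eq_zero_left h1]
    _ = -((H * metricAt w y) * Γ * H + H * Γᵀ * (metricAt w y * H)) := by noncomm_ring
    _ = _ := by rw [hHG, hGH]; noncomm_ring

/-- The covariant derivative of `formMatrix_anticomm`: both `g` and `g⁻¹` are parallel, so only the
derivatives of the two forms survive. -/
theorem covDerivMatrix_linearized (h : IsLocalSU2 w U) (hy : y ∈ U) (a : Fin 4) (i j : Fin 3) :
    covDerivMatrix w i y a * (metricAt w y)⁻¹ * formMatrixAt w j y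
      + formMatrixAt w i y * (metricAt w y)⁻¹ * covDerivMatrix w j y a
      + (covDerivMatrix w j y a * (metricAt w y)⁻¹ * formMatrixAt w i y
      + formMatrixAt w j y * (metricAt w y)⁻¹ * covDerivMatrix w i y a) = 0 := by
  have hac : ∀ z ∈ U, formMatrixAt w i z * (metricAt w z)⁻¹ * formMatrixAt w j z
      + formMatrixAt w j z * (metricAt w z)⁻¹ * formMatrixAt w i z
      = (if i = j then (-2 : ℝ) else 0) • metricAt w z := fun z hz => by
    obtain ⟨Q, hQ⟩ := h.exists_isCoframe hz
    exact hQ.formMatrix_anticomm i j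
  have hΩ : ∀ i, MatrixDifferentiableAt (formMatrixAt w i) y := fun i =>
    (h.smooth_formMatrixAt i).differentiableAt h.isOpen hy
  have hH := h.smooth_inv_metricAt.differentiableAt h.isOpen hy
  have hd := pderivMatrix_congr (h.isOpen.mem_nhds hy) hac a
  rw [pderivMatrix_const_smul (h.smooth_metricAt.differentiableAt h.isOpen hy),
    pderivMatrix_add (((hΩ i).mul hH).mul (hΩ j)) (((hΩ j).mul hH).mul (hΩ i)),
    pderivMatrix_mul ((hΩ i).mul hH) (hΩ j), pderivMatrix_mul ((hΩ j).mul hH) (hΩ i),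
    pderivMatrix_mul (hΩ i) hH, pderivMatrix_mul (hΩ j) hH, h.pderiv_inv_metricAt hy,
    h.pderiv_metricAt hy] at hd
  have hacy := hac y hy
  simp only [covDerivMatrix]
  generalize pderivMatrix (formMatrixAt w i) y a = Di at *
  generalize pderivMatrix (formMatrixAt w j) y a = Dj at *
  generalize christoffelMatrix w y a = Γ at *
  generalize (metricAt w y)⁻¹ = H at *
  generalize metricAt w y = G at *
  generalize formMatrixAt w i y = A at *
  generalize formMatrixAt w j y = B at *
  -- The undifferentiated relation eliminates `G` from the connection terms. What remains is an
  -- identity of noncommutative polynomials, which no longer needs `H` to be the inverse of `G`.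
  have e1 : Γᵀ * (A * H * B + B * H * A) = (if i = j then (-2 : ℝ) else 0) • (Γᵀ * G) := by
    rw [hacy, Matrix.mul_smul]
  have e2 : (A * H * B + B * H * A) * Γ = (if i = j then (-2 : ℝ) else 0) • (G * Γ) := by
    rw [hacy, Matrix.smul_mul]
  rw [smul_add, ← e1, ← e2, ← sub_eq_zero] at hd
  rw [← hd]
  noncomm_ring

/-- The covariant derivative of the triple in terms of the torsion forms. -/
theorem covDerivMatrix_eq (h : IsLocalSU2 w U) (hy : y ∈ U) (a : Fin 4) (i : Fin 3) :
    covDerivMatrix w i y a = torsionCoeff w (i + 2) a y • formMatrixAt w (i + 1) y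
      - torsionCoeff w (i + 1) a y • formMatrixAt w (i + 2) y := by
  obtain ⟨Q, hQ⟩ := h.exists_isCoframe hy
  have key := hQ.eq_of_linearized (C := fun i => covDerivMatrix w i y a)
    (h.covDerivMatrix_transpose hy · a) (h.covDerivMatrix_linearized hy a) i
  have h1 : ∀ i : Fin 3, i + 2 + 1 = i := by decide
  have h2 : ∀ i : Fin 3, i + 2 + 2 = i + 1 := by decide
  have h3 : ∀ i : Fin 3, i + 1 + 1 = i + 2 := by decide
  have h4 : ∀ i : Fin 3, i + 1 + 2 = i := by decide
  simp only [torsionCoeff, h1, h2, h3, h4]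
  exact key

/-- The structure equations `dω_i = a_k ∧ ω_j - a_j ∧ ω_k`, for `(i, j, k)` cyclic. -/
theorem structure_eq (h : IsLocalSU2 w U) (hy : y ∈ U) (i : Fin 3) (a b c : Fin 4) :
    fderiv ℝ (fun z => formMatrixAt w i z b c) y (e a)
      - fderiv ℝ (fun z => formMatrixAt w i z a c) y (e b)
      + fderiv ℝ (fun z => formMatrixAt w i z a b) y (e c)
    = torsionCoeff w (i + 2) a y * formMatrixAt w (i + 1) y b c
      - torsionCoeff w (i + 2) b y * formMatrixAt w (i + 1) y a c
      + torsionCoeff w (i + 2) c y * formMatrixAt w (i + 1) y a b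
      - (torsionCoeff w (i + 1) a y * formMatrixAt w (i + 2) y b c
      - torsionCoeff w (i + 1) b y * formMatrixAt w (i + 2) y a c
      + torsionCoeff w (i + 1) c y * formMatrixAt w (i + 2) y a b) := by
  have hC : ∀ a b c, fderiv ℝ (fun z => formMatrixAt w i z b c) y (e a)
      - ∑ k, christoffel w y k a b * formMatrixAt w i y k c
      - ∑ k, formMatrixAt w i y b k * christoffel w y k a c
      = torsionCoeff w (i + 2) a y * formMatrixAt w (i + 1) y b c
      - torsionCoeff w (i + 1) a y * formMatrixAt w (i + 2) y b c := fun a b c => by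
    have := congrFun (congrFun (h.covDerivMatrix_eq hy a i) b) c
    simpa [covDerivMatrix, pderivMatrix, christoffelMatrix, Matrix.mul_apply] using this
  have hs : ∀ b c, formMatrixAt w i y b c = -formMatrixAt w i y c b := fun b c =>
    congrFun (congrFun (h.formMatrixAt_transpose hy i) c) b
  -- In the alternating sum the six connection terms cancel in pairs, by symmetry of the Christoffel
  -- symbols in their lower indices; one pair also needs skewness of `ω_i`.
  have e1 : ∑ k, christoffel w y k b a * formMatrixAt w i y k c
      = ∑ k, christoffel w y k a b * formMatrixAt w i y k c :=
    Finset.sum_congr rfl fun k _ => by rw [h.christoffel_symm hy k b a]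
  have e2 : ∑ k, formMatrixAt w i y a k * christoffel w y k c b
      = ∑ k, formMatrixAt w i y a k * christoffel w y k b c :=
    Finset.sum_congr rfl fun k _ => by rw [h.christoffel_symm hy k c b]
  have e3 : ∑ k, christoffel w y k c a * formMatrixAt w i y k b
      = -∑ k, formMatrixAt w i y b k * christoffel w y k a c := by
    rw [← Finset.sum_neg_distrib]
    exact Finset.sum_congr rfl fun k _ => by rw [h.christoffel_symm hy k c a, hs k b]; ring
  have h1 := hC a b c
  have h2 := hC b a c
  have h3 := hC c a b
  rw [e1] at h2
  rw [e2, e3] at h3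
  linear_combination h1 - h2 + h3

end IsLocalSU2

/-! ### Exterior derivatives of the torsion forms and the three relations -/

/-- The matrix of the exterior derivative of the torsion form `a_i`. -/
noncomputable def dTorsionMatrix (w : Fin 3 → E4 → E4 [⋀^Fin 2]→L[ℝ] ℝ) (i : Fin 3) (y : E4) :
    Matrix (Fin 4) (Fin 4) ℝ :=
  Matrix.of fun a b => fderiv ℝ (torsionCoeff w i b) y (e a) - fderiv ℝ (torsionCoeff w i a) y (e b)

theorem dTorsionMatrix_transpose (w : Fin 3 → E4 → E4 [⋀^Fin 2]→L[ℝ] ℝ) (i : Fin 3) (y : E4) :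
    (dTorsionMatrix w i y)ᵀ = -dTorsionMatrix w i y := by
  ext a b
  simp [dTorsionMatrix]

theorem torsionForm_apply_e (w : Fin 3 → E4 → E4 [⋀^Fin 2]→L[ℝ] ℝ) (i : Fin 3) (y : E4)
    (v : Fin 1 → E4) {a : Fin 4} (hv : v 0 = e a) : torsionForm w i y v = torsionCoeff w i a y := by
  rw [← comp_torsionForm w i y fun _ => a, comp]
  congr 1
  funext m
  rw [Subsingleton.elim m 0, hv]

theorem quadTorsion_eq (w : Fin 3 → E4 → E4 [⋀^Fin 2]→L[ℝ] ℝ) (i j k : Fin 3) (y : E4) :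
    quadTorsion w i j k y = (fun a => torsionCoeff w i a y) ⬝ᵥ
      ((metricAt w y)⁻¹ *ᵥ ((complexMatrix (fun l => w l y) j)ᵀ *ᵥ
        fun a => torsionCoeff w k a y)) := by
  refine formInner_one _ (comp_torsionForm w i y) fun I => ?_
  have hJ : ∀ c, J (fun l => w l y) j (e (I 0)) c = complexMatrix (fun l => w l y) j c (I 0) :=
    fun c => by simp [J, e, Matrix.ofLp_toEuclideanCLM]
  simp only [comp, Jform, torsionForm_eq, Matrix.mulVec, dotProduct, Matrix.transpose_apply]
  simp [hJ, mul_comm]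

namespace IsLocalSU2

variable {w : Fin 3 → E4 → E4 [⋀^Fin 2]→L[ℝ] ℝ} {U : Set E4} {y : E4}

theorem differentiableAt_torsionForm (h : IsLocalSU2 w U) (hy : y ∈ U) (i : Fin 3) :
    DifferentiableAt ℝ (torsionForm w i) y := by
  rw [funext (torsionForm_eq w i)]
  exact DifferentiableAt.fun_sum fun a _ => (h.differentiableAt_torsionCoeff hy i a).smul_const _

theorem dTorsion_eq (h : IsLocalSU2 w U) (hy : y ∈ U) (i j : Fin 3) :
    dTorsion w i j y = inner₂ (metricAt w y) (dTorsionMatrix w i y) (formMatrixAt w j y) := by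
  refine formInner_two _ (fun I => ?_) fun I => by rw [comp_two]; rfl
  rw [comp, extDeriv_apply (h.differentiableAt_torsionForm hy i), Fin.sum_univ_two]
  have h0 : (fun z => torsionForm w i z ((0 : Fin 2).removeNth fun m => e (I m)))
      = torsionCoeff w i (I 1) := funext fun z => torsionForm_apply_e w i z _ rfl
  have h1 : (fun z => torsionForm w i z ((1 : Fin 2).removeNth fun m => e (I m)))
      = torsionCoeff w i (I 0) := funext fun z => torsionForm_apply_e w i z _ rfl
  rw [h0, h1]
  simp [dTorsionMatrix, sub_eq_add_neg]

/-- The derivative of the structure equations. -/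
theorem pderiv_structure_eq (h : IsLocalSU2 w U) (hy : y ∈ U) (i : Fin 3) (a b c d : Fin 4) :
    fderiv ℝ (fun z => fderiv ℝ (fun z => formMatrixAt w i z b c) z (e a)) y (e d)
      - fderiv ℝ (fun z => fderiv ℝ (fun z => formMatrixAt w i z a c) z (e b)) y (e d)
      + fderiv ℝ (fun z => fderiv ℝ (fun z => formMatrixAt w i z a b) z (e c)) y (e d)
    = (fderiv ℝ (torsionCoeff w (i + 2) a) y (e d) * formMatrixAt w (i + 1) y b c
        - fderiv ℝ (torsionCoeff w (i + 2) b) y (e d) * formMatrixAt w (i + 1) y a c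
        + fderiv ℝ (torsionCoeff w (i + 2) c) y (e d) * formMatrixAt w (i + 1) y a b
        - (fderiv ℝ (torsionCoeff w (i + 1) a) y (e d) * formMatrixAt w (i + 2) y b c
        - fderiv ℝ (torsionCoeff w (i + 1) b) y (e d) * formMatrixAt w (i + 2) y a c
        + fderiv ℝ (torsionCoeff w (i + 1) c) y (e d) * formMatrixAt w (i + 2) y a b))
      + (torsionCoeff w (i + 2) a y * fderiv ℝ (fun z => formMatrixAt w (i + 1) z b c) y (e d)
        - torsionCoeff w (i + 2) b y * fderiv ℝ (fun z => formMatrixAt w (i + 1) z a c) y (e d)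
        + torsionCoeff w (i + 2) c y * fderiv ℝ (fun z => formMatrixAt w (i + 1) z a b) y (e d)
        - (torsionCoeff w (i + 1) a y * fderiv ℝ (fun z => formMatrixAt w (i + 2) z b c) y (e d)
        - torsionCoeff w (i + 1) b y * fderiv ℝ (fun z => formMatrixAt w (i + 2) z a c) y (e d)
        + torsionCoeff w (i + 1) c y
          * fderiv ℝ (fun z => formMatrixAt w (i + 2) z a b) y (e d))) := by
  have hA := fun i a => (h.differentiableAt_torsionCoeff hy i a).hasFDerivAt
  have hΩ := fun i b c =>
    ((h.smooth_formMatrixAt i).differentiableAt h.isOpen hy b c).hasFDerivAt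
  have hD := fun a b c => (((h.contDiffOn_pderiv (h.smooth_formMatrixAt i b c) a).contDiffAt
    (h.isOpen.mem_nhds hy)).differentiableAt (by simp)).hasFDerivAt
  have hL := ((hD a b c).fun_sub (hD b a c)).fun_add (hD c a b)
  have hT := fun j k => (((hA j a).fun_mul (hΩ k b c)).fun_sub
    ((hA j b).fun_mul (hΩ k a c))).fun_add ((hA j c).fun_mul (hΩ k a b))
  have hR := (hT (i + 2) (i + 1)).fun_sub (hT (i + 1) (i + 2))
  have heq := hL.congr_of_eventuallyEq (f₁ := _) (by
    filter_upwards [h.isOpen.mem_nhds hy] with z hz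
    exact (h.structure_eq hz i a b c).symm)
  have := DFunLike.congr_fun (heq.unique hR) (e d)
  simp only [_root_.sub_apply, _root_.add_apply, _root_.smul_apply, smul_eq_mul] at this
  linear_combination this

theorem pderiv_comm (h : IsLocalSU2 w U) (hy : y ∈ U) (i : Fin 3) (b c a d : Fin 4) :
    fderiv ℝ (fun z => fderiv ℝ (fun z => formMatrixAt w i z b c) z (e a)) y (e d)
      = fderiv ℝ (fun z => fderiv ℝ (fun z => formMatrixAt w i z b c) z (e d)) y (e a) := by
  have hc := (h.smooth_formMatrixAt i b c).contDiffAt (h.isOpen.mem_nhds hy)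
  have hs : IsSymmSndFDerivAt ℝ (fun z => formMatrixAt w i z b c) y :=
    hc.isSymmSndFDerivAt (by rw [minSmoothness_of_isRCLikeNormedField]; exact WithTop.coe_le_coe.mpr le_top)
  have hd : DifferentiableAt ℝ (fderiv ℝ fun z => formMatrixAt w i z b c) y :=
    (((h.smooth_formMatrixAt i b c).fderiv_of_isOpen (m := ∞) h.isOpen (by simp)).contDiffAt
      (h.isOpen.mem_nhds hy)).differentiableAt (by simp)
  rw [fderiv_clm_apply hd (differentiableAt_const _), fderiv_clm_apply hd (differentiableAt_const _)]
  simpa using hs (e d) (e a)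

/-- The consequence of `d² ω_i = 0`. -/
theorem wedge_dTorsion (h : IsLocalSU2 w U) (hy : y ∈ U) (i : Fin 3) :
    wedge (dTorsionMatrix w (i + 1) y) (formMatrixAt w (i + 2) y)
      = wedge (dTorsionMatrix w (i + 2) y) (formMatrixAt w (i + 1) y)
      + wedge (vecMulVec (fun a => torsionCoeff w i a y) (fun a => torsionCoeff w (i + 1) a y)
          - vecMulVec (fun a => torsionCoeff w (i + 1) a y) (fun a => torsionCoeff w i a y))
          (formMatrixAt w (i + 1) y)
      + wedge (vecMulVec (fun a => torsionCoeff w i a y) (fun a => torsionCoeff w (i + 2) a y)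
          - vecMulVec (fun a => torsionCoeff w (i + 2) a y) (fun a => torsionCoeff w i a y))
          (formMatrixAt w (i + 2) y) := by
  have h0 := h.pderiv_structure_eq hy i 1 2 3 0
  have h1 := h.pderiv_structure_eq hy i 0 2 3 1
  have h2 := h.pderiv_structure_eq hy i 0 1 3 2
  have h3 := h.pderiv_structure_eq hy i 0 1 2 3
  have s01 := h.pderiv_comm hy i 2 3 0 1
  have s02 := h.pderiv_comm hy i 1 3 0 2
  have s03 := h.pderiv_comm hy i 1 2 0 3
  have s12 := h.pderiv_comm hy i 0 3 1 2
  have s13 := h.pderiv_comm hy i 0 2 1 3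
  have s23 := h.pderiv_comm hy i 0 1 2 3
  have e1 : ∀ i : Fin 3, i + 1 + 2 = i := by decide
  have e2 : ∀ i : Fin 3, i + 1 + 1 = i + 2 := by decide
  have e3 : ∀ i : Fin 3, i + 2 + 2 = i + 1 := by decide
  have e4 : ∀ i : Fin 3, i + 2 + 1 = i := by decide
  -- These replace the derivatives of `ω_j` and `ω_k` that the Leibniz rule produces.
  have hj := h.structure_eq hy (i + 1)
  have hk := h.structure_eq hy (i + 2)
  simp only [e1, e2, e3, e4] at hj hk
  simp only [wedge, dTorsionMatrix, Matrix.of_apply, Matrix.sub_apply, Matrix.vecMulVec_apply]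
  -- The alternating sum of `h0`, ..., `h3` is the `0123` component of `d` applied to the structure
  -- equation. The symmetry of second derivatives removes its left side, and the multiples of `hj`,
  -- `hk` are the terms `a_k ∧ dω_j` and `a_j ∧ dω_k`.
  linear_combination h0 - h1 + h2 - h3 + s01 - s02 + s03 + s12 - s13 + s23
    - torsionCoeff w (i + 2) 0 y * hj 1 2 3 + torsionCoeff w (i + 2) 1 y * hj 0 2 3
    - torsionCoeff w (i + 2) 2 y * hj 0 1 3 + torsionCoeff w (i + 2) 3 y * hj 0 1 2
    + torsionCoeff w (i + 1) 0 y * hk 1 2 3 - torsionCoeff w (i + 1) 1 y * hk 0 2 3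
    + torsionCoeff w (i + 1) 2 y * hk 0 1 3 - torsionCoeff w (i + 1) 3 y * hk 0 1 2

theorem dTorsion_relation (h : IsLocalSU2 w U) (hy : y ∈ U) (i : Fin 3) :
    dTorsion w (i + 1) (i + 2) y = dTorsion w (i + 2) (i + 1) y
      + quadTorsion w i (i + 1) (i + 1) y + quadTorsion w i (i + 2) (i + 2) y := by
  obtain ⟨Q, hQ⟩ := h.exists_isCoframe hy
  have hd := h.wedge_dTorsion hy i
  have hv : ∀ u v : Fin 4 → ℝ, (vecMulVec u v - vecMulVec v u)ᵀ
      = -(vecMulVec u v - vecMulVec v u) := fun u v => by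
    ext a b
    simp [Matrix.vecMulVec_apply, mul_comm]
  have hw : ∀ (X : Matrix (Fin 4) (Fin 4) ℝ) (j : Fin 3), Xᵀ = -X →
      wedge X (formMatrixAt w j y) = Q.det * inner₂ (metricAt w y) X (formMatrixAt w j y) :=
    fun X j hX => hQ.wedge_formMatrix hX j
  rw [hw _ _ (dTorsionMatrix_transpose w _ y), hw _ _ (dTorsionMatrix_transpose w _ y),
    hw _ _ (hv _ _), hw _ _ (hv _ _), ← mul_add, ← mul_add] at hd
  -- Every wedge carries the same factor `Q.det`, so it cancels whatever its sign; no orientation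
  -- has to be chosen.
  replace hd := mul_left_cancel₀ hQ.isUnit_det.ne_zero hd
  rw [h.dTorsion_eq hy, h.dTorsion_eq hy, hd, quadTorsion_eq, quadTorsion_eq]
  congr 1
  · congr 1
    exact hQ.inner₂_vecMulVec _ _ _
  · exact hQ.inner₂_vecMulVec _ _ _

end IsLocalSU2

/-! ### Passage from a manifold to its charts -/

section Pullback

variable {V : Type*} [AddCommGroup V] [Module ℝ V] [TopologicalSpace V]
  {W : Type*} [AddCommGroup W] [Module ℝ W] [TopologicalSpace W]

theorem IsSU2Triple.compContinuousLinearMap {p : Fin 3 → V [⋀^Fin 2]→L[ℝ] ℝ}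
    (hp : IsSU2Triple p) (L : W →L[ℝ] V) (hL : Function.Bijective L) :
    IsSU2Triple fun i => (p i).compContinuousLinearMap L := by
  obtain ⟨b, hb⟩ := hp
  let L' : W ≃ₗ[ℝ] V := LinearEquiv.ofBijective L.toLinearMap hL
  refine ⟨b.map L'.symm, fun u v => ?_⟩
  have hc : ∀ a (u : W), (b.map L'.symm).coord a u = b.coord a (L u) := fun a u => by
    simp [L']
  have hv : ∀ i, (p i).compContinuousLinearMap L ![u, v] = p i ![L u, L v] := fun i => by
    rw [ContinuousAlternatingMap.compContinuousLinearMap_apply]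
    congr 1
    funext m
    fin_cases m <;> rfl
  simp only [hv, dx, hc]
  exact hb (L u) (L v)

end Pullback

section Manifold

variable {M : Type*} [TopologicalSpace M] [ChartedSpace E4 M]

theorem bijective_mfderiv_symm {φ : OpenPartialHomeomorph M E4}
    (hφ : φ ∈ IsManifold.maximalAtlas (𝓡 4) ∞ M) {y : E4} (hy : y ∈ φ.target) :
    Function.Bijective
      (mfderiv 𝓘(ℝ, E4) (𝓡 4) φ.symm y : E4 →L[ℝ] TangentSpace (𝓡 4) (φ.symm y)) := by
  have hx : φ.symm y ∈ φ.source := φ.map_target hy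
  have h1 : MDifferentiableAt (𝓡 4) 𝓘(ℝ, E4) φ (φ.symm y) :=
    ((contMDiffOn_of_mem_maximalAtlas hφ).contMDiffAt (φ.open_source.mem_nhds hx)).mdifferentiableAt
      (by simp)
  have h2 : MDifferentiableAt 𝓘(ℝ, E4) (𝓡 4) φ.symm y :=
    ((contMDiffOn_symm_of_mem_maximalAtlas hφ).contMDiffAt
      (φ.open_target.mem_nhds hy)).mdifferentiableAt (by simp)
  have hφy : φ (φ.symm y) = y := φ.right_inv hy
  have key1 : (mfderiv (𝓡 4) 𝓘(ℝ, E4) φ (φ.symm y)).comp (mfderiv 𝓘(ℝ, E4) (𝓡 4) φ.symm y)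
      = ContinuousLinearMap.id ℝ E4 := by
    rw [← mfderiv_comp y h1 h2]
    have : (φ ∘ φ.symm) =ᶠ[𝓝 y] id := by
      filter_upwards [φ.open_target.mem_nhds hy] with z hz
      exact φ.right_inv hz
    rw [this.mfderiv_eq]
    exact mfderiv_id
  have key2 : (mfderiv 𝓘(ℝ, E4) (𝓡 4) φ.symm y).comp (mfderiv (𝓡 4) 𝓘(ℝ, E4) φ (φ.symm y))
      = ContinuousLinearMap.id ℝ (TangentSpace (𝓡 4) (φ.symm y)) := by
    have h2' : MDifferentiableAt 𝓘(ℝ, E4) (𝓡 4) φ.symm (φ (φ.symm y)) := by rwa [hφy]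
    have := mfderiv_comp (φ.symm y) h2' h1
    have he : (φ.symm ∘ φ) =ᶠ[𝓝 (φ.symm y)] id := by
      filter_upwards [φ.open_source.mem_nhds hx] with z hz
      exact φ.left_inv hz
    rw [he.mfderiv_eq, mfderiv_id] at this
    rw [this, hφy]
  refine Function.bijective_iff_has_inverse.mpr
    ⟨mfderiv (𝓡 4) 𝓘(ℝ, E4) φ (φ.symm y), fun u => ?_, fun u => ?_⟩
  · exact DFunLike.congr_fun key1 u
  · exact DFunLike.congr_fun key2 u

/-- All torsion quantities are computed from the chart expressions, so this reduces the relations on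
a manifold to those on an open subset of `ℝ⁴`. -/
theorem SU2Structure.isLocalSU2_inChart (S : SU2Structure M) {φ : OpenPartialHomeomorph M E4}
    (hφ : φ ∈ IsManifold.maximalAtlas (𝓡 4) ∞ M) : IsLocalSU2 (S.inChart φ) φ.target where
  isOpen := φ.open_target
  smooth i := S.smooth i φ hφ
  isSU2Triple y hy :=
    (S.isSU2Triple (φ.symm y)).compContinuousLinearMap _ (bijective_mfderiv_symm hφ hy)

end Manifold

/-! ### Constant and varying `2`-forms on `ℝ⁴` -/

/-- The `2`-form with the matrix `N - Nᵀ`. -/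
noncomputable def matrixForm (N : Matrix (Fin 4) (Fin 4) ℝ) : E4 [⋀^Fin 2]→L[ℝ] ℝ :=
  ∑ a, ∑ b, N a b • ContinuousMultilinearMap.alternatization
    ((ContinuousMultilinearMap.mkPiAlgebra ℝ (Fin 2) ℝ).compContinuousLinearMap
      fun m => (EuclideanSpace.proj (![a, b] m) : E4 →L[ℝ] ℝ))

theorem matrixForm_apply (N : Matrix (Fin 4) (Fin 4) ℝ) (u v : E4) :
    matrixForm N ![u, v] = ∑ a, ∑ b, N a b * (u a * v b - u b * v a) := by
  have hp : ∀ f : Equiv.Perm (Fin 2) → ℝ, ∑ σ, f σ = f 1 + f (Equiv.swap 0 1) := fun f => by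
    rw [show (Finset.univ : Finset (Equiv.Perm (Fin 2))) = {1, Equiv.swap 0 1} from by decide,
      Finset.sum_pair (by decide)]
  simp only [matrixForm, ContinuousAlternatingMap.sum_apply, ContinuousAlternatingMap.smul_apply]
  refine Finset.sum_congr rfl fun a _ => Finset.sum_congr rfl fun b _ => ?_
  rw [ContinuousMultilinearMap.alternatization_apply_apply, hp]
  simp only [Equiv.Perm.sign_one, Equiv.Perm.sign_swap (zero_ne_one' (Fin 2))]
  simp [mul_comm]
  left
  ring

theorem matrixForm_of_comp (α : E4 [⋀^Fin 2]→L[ℝ] ℝ) :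
    matrixForm (Matrix.of fun a b => (1 / 2) * α ![e a, e b]) = α := by
  have hα : ∀ u v, α ![v, u] = -α ![u, v] := fun u v => by
    have := α.map_swap ![u, v] (i := 0) (j := 1) (by decide)
    refine Eq.trans ?_ this
    change α _ = α _
    congr 1
    funext m
    fin_cases m <;> rfl
  ext v
  have hv : v = ![v 0, v 1] := by
    funext m
    fin_cases m <;> rfl
  rw [hv, matrixForm_apply, apply_two]
  simp only [mul_sub, Finset.sum_sub_distrib]
  rw [sub_eq_iff_eq_add, ← sub_eq_iff_eq_add']
  conv_rhs => rw [Finset.sum_comm]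
  simp only [← Finset.sum_sub_distrib]
  refine Finset.sum_congr rfl fun a _ => Finset.sum_congr rfl fun b _ => ?_
  simp only [Matrix.of_apply, hα (e a) (e b)]
  ring

/-- A `2`-form is a fixed linear combination of constant forms weighted by its components, by
`matrixForm_of_comp`. -/
theorem contDiffOn_of_comp {β : E4 → E4 [⋀^Fin 2]→L[ℝ] ℝ} {U : Set E4}
    (h : ∀ a b, ContDiffOn ℝ ∞ (fun z => β z ![e a, e b]) U) : ContDiffOn ℝ ∞ β U := by
  have : β = fun z => matrixForm (Matrix.of fun a b => (1 / 2) * β z ![e a, e b]) :=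
    funext fun z => (matrixForm_of_comp (β z)).symm
  rw [this]
  unfold matrixForm
  exact ContDiffOn.sum fun a _ => ContDiffOn.sum fun b _ =>
    (contDiffOn_const.mul (h a b)).smul contDiffOn_const

/-- An `SU2Structure` demands smoothness in every chart of the maximal atlas, not only in the
identity chart. Components in another chart are polynomial in the derivative of the inverse chart
and the original components. -/
theorem contDiffOn_localForm {β : E4 → E4 [⋀^Fin 2]→L[ℝ] ℝ} (hβ : ContDiff ℝ ∞ β)
    {φ : OpenPartialHomeomorph E4 E4} (hφ : φ ∈ IsManifold.maximalAtlas (𝓡 4) ∞ E4) :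
    ContDiffOn ℝ ∞ (localForm φ β) φ.target := by
  have hs : ContDiffOn ℝ ∞ φ.symm φ.target :=
    contMDiffOn_iff_contDiffOn.mp (contMDiffOn_symm_of_mem_maximalAtlas hφ)
  have hd : ContDiffOn ℝ ∞ (fderiv ℝ φ.symm) φ.target :=
    hs.fderiv_of_isOpen φ.open_target (by simp)
  refine contDiffOn_of_comp fun a b => ?_
  have he : ∀ z, localForm φ β z ![e a, e b] = ∑ c, ∑ d, fderiv ℝ φ.symm z (e a) c
      * fderiv ℝ φ.symm z (e b) d * β (φ.symm z) ![e c, e d] := fun z => by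
    rw [← apply_two, ← mfderiv_eq_fderiv]
    change β (φ.symm z) _ = _
    congr 1
    funext m
    fin_cases m <;> rfl
  simp only [he]
  have hc : ∀ a c, ContDiffOn ℝ ∞ (fun z => fderiv ℝ φ.symm z (e a) c) φ.target := fun a c =>
    (EuclideanSpace.proj c : E4 →L[ℝ] ℝ).contDiff.comp_contDiffOn
      (hd.clm_apply contDiffOn_const)
  exact ContDiffOn.sum fun c _ => ContDiffOn.sum fun d _ => ((hc a c).mul (hc b d)).mul
    ((ContinuousAlternatingMap.apply ℝ E4 ℝ ![e c, e d]).contDiff.comp_contDiffOn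
      (hβ.comp_contDiffOn hs))

theorem localForm_refl (β : E4 → E4 [⋀^Fin 2]→L[ℝ] ℝ) :
    localForm (OpenPartialHomeomorph.refl E4) β = β := by
  funext y
  have h : mfderiv 𝓘(ℝ, E4) (𝓡 4) (OpenPartialHomeomorph.refl E4).symm y
      = ContinuousLinearMap.id ℝ E4 := mfderiv_id
  change (β y).compContinuousLinearMap (mfderiv 𝓘(ℝ, E4) (𝓡 4)
    (OpenPartialHomeomorph.refl E4).symm y : E4 →L[ℝ] E4) = β y
  rw [h]
  rfl

/-! ### Triples that agree with the standard one to first order at the origin -/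

/-- The homogeneous quadratic polynomial with coefficient matrix `B`. -/
noncomputable def quadPoly (B : Matrix (Fin 4) (Fin 4) ℝ) (y : E4) : ℝ :=
  ∑ a, ∑ b, B a b * (y a * y b)

theorem contDiff_quadPoly (B : Matrix (Fin 4) (Fin 4) ℝ) : ContDiff ℝ ∞ (quadPoly B) := by
  have hp : ∀ a, ContDiff ℝ ∞ fun y : E4 => y a := fun a =>
    (EuclideanSpace.proj a : E4 →L[ℝ] ℝ).contDiff
  exact ContDiff.sum fun a _ => ContDiff.sum fun b _ => contDiff_const.mul ((hp a).mul (hp b))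

theorem fderiv_quadPoly (B : Matrix (Fin 4) (Fin 4) ℝ) (y : E4) (c : Fin 4) :
    fderiv ℝ (quadPoly B) y (e c) = ∑ b, (B c b + B b c) * y b := by
  have hp : ∀ a, HasFDerivAt (fun y : E4 => y a) (EuclideanSpace.proj a : E4 →L[ℝ] ℝ) y :=
    fun a => (EuclideanSpace.proj a : E4 →L[ℝ] ℝ).hasFDerivAt
  have h : HasFDerivAt (quadPoly B) _ y := HasFDerivAt.fun_sum fun a _ =>
    HasFDerivAt.fun_sum fun b _ => ((hp a).fun_mul (hp b)).const_mul (B a b)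
  rw [h.fderiv]
  simp [e, Finset.sum_add_distrib, add_mul]
  exact add_comm _ _

theorem fderiv_fderiv_quadPoly (B : Matrix (Fin 4) (Fin 4) ℝ) (y : E4) (c d : Fin 4) :
    fderiv ℝ (fun z => fderiv ℝ (quadPoly B) z (e c)) y (e d) = B c d + B d c := by
  simp only [fderiv_quadPoly]
  have hp : ∀ a, HasFDerivAt (fun y : E4 => y a) (EuclideanSpace.proj a : E4 →L[ℝ] ℝ) y :=
    fun a => (EuclideanSpace.proj a : E4 →L[ℝ] ℝ).hasFDerivAt
  have h := HasFDerivAt.fun_sum (u := Finset.univ) fun b _ =>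
    (hp b).const_mul (B c b + B b c)
  rw [h.fderiv]
  simp [e]

/-- The matrix of `dx_0 ∧ (v_0 dx_1 + v_1 dx_2 + v_2 dx_3)`. -/
def wedgeMatrix (v : Fin 3 → ℝ) : Matrix (Fin 4) (Fin 4) ℝ :=
  !![0, v 0, v 1, v 2; -v 0, 0, 0, 0; -v 1, 0, 0, 0; -v 2, 0, 0, 0]

/-- The directions in which the standard triple moves when its coframe is changed to
`dx_0`, `dx_{k+1} + q_k dx_0`. -/
def shearMatrix (i k : Fin 3) : Matrix (Fin 4) (Fin 4) ℝ :=
  wedgeMatrix fun l =>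
    if k = i + 1 ∧ l = i + 2 then 1 else if k = i + 2 ∧ l = i + 1 then -1 else 0

theorem wedgeMatrix_transpose (v : Fin 3 → ℝ) : (wedgeMatrix v)ᵀ = -wedgeMatrix v := by
  ext a b
  fin_cases a <;> fin_cases b <;> simp [wedgeMatrix]

theorem sum_wedgeMatrix_mul (v : Fin 3 → Fin 3 → ℝ) (f : Fin 3 → ℝ) (b c : Fin 4) :
    ∑ k, wedgeMatrix (v k) b c * f k = wedgeMatrix (fun l => ∑ k, v k l * f k) b c := by
  fin_cases b <;> fin_cases c <;> simp [wedgeMatrix]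

theorem sum_shearMatrix_mul (i : Fin 3) (f : Fin 3 → ℝ) (b c : Fin 4) :
    ∑ k, shearMatrix i k b c * f k
      = wedgeMatrix (fun l => if l = i + 2 then f (i + 1) else if l = i + 1 then -f (i + 2) else 0)
        b c := by
  refine (sum_wedgeMatrix_mul _ f b c).trans ?_
  congr 2
  funext l
  rw [Fin.sum_univ_three]
  fin_cases i <;> fin_cases l <;> simp

/-- The triple that is standard in the coframe `dx_0`, `dx_{k+1} + q_k dx_0`, where `q_k` is the
quadratic polynomial with coefficient matrix `B k`. -/
noncomputable def shearForm (B : Fin 3 → Matrix (Fin 4) (Fin 4) ℝ) (i : Fin 3) (y : E4) :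
    E4 [⋀^Fin 2]→L[ℝ] ℝ :=
  matrixForm ((1 / 2 : ℝ) • (stdMatrix i + ∑ k, quadPoly (B k) y • shearMatrix i k))

theorem shearMatrix_transpose (i k : Fin 3) : (shearMatrix i k)ᵀ = -shearMatrix i k :=
  wedgeMatrix_transpose _

theorem matrixForm_apply_e {X : Matrix (Fin 4) (Fin 4) ℝ} (hX : Xᵀ = -X) (a b : Fin 4) :
    matrixForm ((1 / 2 : ℝ) • X) ![e a, e b] = X a b := by
  have hs : X b a = -X a b := congrFun (congrFun hX a) b
  rw [matrixForm_apply]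
  simp [e, mul_sub, Finset.sum_sub_distrib, hs]
  ring

section Shear

variable (B : Fin 3 → Matrix (Fin 4) (Fin 4) ℝ)

theorem formMatrixAt_shearForm (i : Fin 3) (y : E4) (b c : Fin 4) :
    formMatrixAt (shearForm B) i y b c
      = stdMatrix i b c + ∑ k, shearMatrix i k b c * quadPoly (B k) y := by
  rw [formMatrixAt, formMatrix, Matrix.of_apply, shearForm, matrixForm_apply_e]
  · simp [Matrix.sum_apply, mul_comm]
  · simp [Matrix.transpose_sum, stdMatrix_transpose, shearMatrix_transpose, add_comm]

theorem contDiff_shearForm (i : Fin 3) : ContDiff ℝ ∞ (shearForm B i) := by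
  rw [← contDiffOn_univ]
  refine contDiffOn_of_comp fun a b => ?_
  have : (fun z => shearForm B i z ![e a, e b])
      = fun z => stdMatrix i a b + ∑ k, shearMatrix i k a b * quadPoly (B k) z :=
    funext fun z => formMatrixAt_shearForm B i z a b
  rw [this, contDiffOn_univ]
  exact contDiff_const.add (ContDiff.sum fun k _ => contDiff_const.mul (contDiff_quadPoly (B k)))

/-- The coframe `dx_0`, `dx_{k+1} + q_k dx_0` as a linear isomorphism to `ℝ⁴`. -/
def shearEquiv (q : Fin 3 → ℝ) : E4 ≃ₗ[ℝ] (Fin 4 → ℝ) where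
  toFun u := ![u 0, u 1 + q 0 * u 0, u 2 + q 1 * u 0, u 3 + q 2 * u 0]
  invFun v := !₂[v 0, v 1 - q 0 * v 0, v 2 - q 1 * v 0, v 3 - q 2 * v 0]
  map_add' u v := by ext a; fin_cases a <;> simp <;> ring
  map_smul' r u := by ext a; fin_cases a <;> simp <;> ring
  left_inv u := by ext a; fin_cases a <;> simp
  right_inv v := by ext a; fin_cases a <;> simp

/-- Expanding the standard formulas in the sheared coframe, products of two `q_k` multiply `dx_0 ∧
dx_0 = 0`. The triple is therefore exactly affine in the `q_k`, as `shearForm` asserts. -/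
theorem isSU2Triple_shearForm (y : E4) : IsSU2Triple fun i => shearForm B i y := by
  refine ⟨Module.Basis.ofEquivFun (shearEquiv fun k => quadPoly (B k) y), fun u v => ?_⟩
  have hc : ∀ a u, (Module.Basis.ofEquivFun (shearEquiv fun k => quadPoly (B k) y)).coord a u
      = ![u 0, u 1 + quadPoly (B 0) y * u 0, u 2 + quadPoly (B 1) y * u 0,
        u 3 + quadPoly (B 2) y * u 0] a := fun a u => by
    simp [Module.Basis.coord_apply, shearEquiv]
  simp only [dx, hc]
  generalize hq : (fun k => quadPoly (B k) y) = q
  have hq' : ∀ k, quadPoly (B k) y = q k := fun k => congrFun hq k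
  have h : ∀ i, shearForm B i y ![u, v] = ∑ a, ∑ b,
      u a * v b * (stdMatrix i a b + ∑ k, shearMatrix i k a b * q k) := fun i => by
    rw [apply_two]
    simp only [← hq', ← formMatrixAt_shearForm]
    rfl
  simp only [h, hq', sum_shearMatrix_mul]
  refine ⟨?_, ?_, ?_⟩ <;>
  · simp [Fin.sum_univ_four, stdMatrix, wedgeMatrix]
    ring

/-- The `SU(2)`-structure on `ℝ⁴` given by `shearForm`. -/
noncomputable def shearStructure : SU2Structure E4 where
  form i := shearForm B i
  smooth i _ hφ := contDiffOn_localForm (contDiff_shearForm B i) hφ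
  isSU2Triple := isSU2Triple_shearForm B

theorem shearStructure_inChart_refl :
    (shearStructure B).inChart (OpenPartialHomeomorph.refl E4) = shearForm B :=
  funext fun i => localForm_refl (shearForm B i)

theorem isLocalSU2_shearForm : IsLocalSU2 (shearForm B) Set.univ where
  isOpen := isOpen_univ
  smooth i := (contDiff_shearForm B i).contDiffOn
  isSU2Triple y _ := isSU2Triple_shearForm B y

theorem quadPoly_zero (C : Matrix (Fin 4) (Fin 4) ℝ) : quadPoly C 0 = 0 := by
  simp [quadPoly]

theorem formMatrixAt_shearForm_zero (i : Fin 3) : formMatrixAt (shearForm B) i 0 = stdMatrix i := by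
  ext b c
  simp [formMatrixAt_shearForm, quadPoly_zero]

theorem metricAt_shearForm_zero : metricAt (shearForm B) 0 = 1 := by
  have : IsCoframe (fun i => shearForm B i 0) 1 :=
    ⟨by simp, fun i => (formMatrixAt_shearForm_zero B i).trans (by simp)⟩
  exact this.metric_eq.trans (by simp)

theorem fderiv_shearForm (i : Fin 3) (b c : Fin 4) (y : E4) (a : Fin 4) :
    fderiv ℝ (fun z => formMatrixAt (shearForm B) i z b c) y (e a)
      = ∑ k, shearMatrix i k b c * fderiv ℝ (quadPoly (B k)) y (e a) := by
  simp only [formMatrixAt_shearForm]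
  have hd : ∀ k, HasFDerivAt (quadPoly (B k)) (fderiv ℝ (quadPoly (B k)) y) y := fun k =>
    ((contDiff_quadPoly (B k)).differentiable (by simp) y).hasFDerivAt
  have h := (HasFDerivAt.fun_sum (u := Finset.univ) fun k _ =>
    (hd k).const_mul (shearMatrix i k b c)).const_add (stdMatrix i b c)
  rw [h.fderiv]
  simp

theorem fderiv_shearForm_zero (i : Fin 3) (b c a : Fin 4) :
    fderiv ℝ (fun z => formMatrixAt (shearForm B) i z b c) 0 (e a) = 0 := by
  simp [fderiv_shearForm, fderiv_quadPoly]

theorem fderiv_fderiv_shearForm (i : Fin 3) (b c : Fin 4) (a d : Fin 4) :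
    fderiv ℝ (fun z => fderiv ℝ (fun z => formMatrixAt (shearForm B) i z b c) z (e a)) 0 (e d)
      = ∑ k, shearMatrix i k b c * (B k a d + B k d a) := by
  simp only [fderiv_shearForm, ← fderiv_fderiv_quadPoly (B _) 0]
  have hd : ∀ k, DifferentiableAt ℝ (fun z => fderiv ℝ (quadPoly (B k)) z (e a)) 0 := fun k => by
    simp only [fderiv_quadPoly]
    have hp : ∀ a, DifferentiableAt ℝ (fun y : E4 => y a) 0 :=
      fun a => (EuclideanSpace.proj a : E4 →L[ℝ] ℝ).differentiableAt
    exact DifferentiableAt.fun_sum fun b _ => (hp b).const_mul _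
  have h := HasFDerivAt.fun_sum (u := Finset.univ) fun k _ =>
    (hd k).hasFDerivAt.const_mul (shearMatrix i k b c)
  rw [h.fderiv]
  simp

end Shear

/-! ### The torsion of a sheared triple and its first derivatives at the origin -/

/-- The map from torsion forms to the exterior derivatives of the standard triple is injective. -/
theorem torsion_eq_of_structure_eq {x : Fin 3 → Fin 4 → ℝ} {F : Fin 3 → Fin 4 → Fin 4 → Fin 4 → ℝ}
    (h : ∀ i a b c, F i a b c = x (i + 2) a * stdMatrix (i + 1) b c
      - x (i + 2) b * stdMatrix (i + 1) a c + x (i + 2) c * stdMatrix (i + 1) a b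
      - (x (i + 1) a * stdMatrix (i + 2) b c - x (i + 1) b * stdMatrix (i + 2) a c
      + x (i + 1) c * stdMatrix (i + 2) a b)) :
    x = 1 / 2 * ![![F 0 1 2 3 + F 1 0 1 2 + F 2 0 1 3, -F 0 0 2 3 - F 1 0 1 3 + F 2 0 1 2,
        F 0 0 1 3 - F 1 0 2 3 - F 2 1 2 3, -F 0 0 1 2 + F 1 1 2 3 - F 2 0 2 3],
      ![-F 0 0 1 2 + F 1 1 2 3 + F 2 0 2 3, F 0 0 1 3 - F 1 0 2 3 + F 2 1 2 3,
        F 0 0 2 3 + F 1 0 1 3 + F 2 0 1 2, -F 0 1 2 3 - F 1 0 1 2 + F 2 0 1 3],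
      ![-F 0 0 1 3 - F 1 0 2 3 + F 2 1 2 3, -F 0 0 1 2 - F 1 1 2 3 - F 2 0 2 3,
        F 0 1 2 3 - F 1 0 1 2 + F 2 0 1 3, F 0 0 2 3 - F 1 0 1 3 - F 2 0 1 2]] := by
  have h0 := h 0
  have h1 := h 1
  have h2 := h 2
  funext i a
  fin_cases i <;> fin_cases a <;> simp [h0, h1, h2, stdMatrix] <;> ring

section Shear

variable (B : Fin 3 → Matrix (Fin 4) (Fin 4) ℝ)

/-- The first derivatives of the triple vanish at the origin, so the structure equations there are
homogeneous, and they are injective in the torsion. -/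
theorem torsionCoeff_shearForm_zero (i : Fin 3) (a : Fin 4) :
    torsionCoeff (shearForm B) i a 0 = 0 := by
  have h := torsion_eq_of_structure_eq (x := fun i a => torsionCoeff (shearForm B) i a 0)
    (F := fun _ _ _ _ => 0) fun i a b c => by
      have := (isLocalSU2_shearForm B).structure_eq (Set.mem_univ 0) i a b c
      simp only [fderiv_shearForm_zero, formMatrixAt_shearForm_zero] at this
      linarith
  have := congrFun (congrFun h i) a
  refine this.trans ?_
  fin_cases i <;> fin_cases a <;> simp

theorem torsionForm_shearForm_zero (i : Fin 3) : torsionForm (shearForm B) i 0 = 0 := by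
  simp [torsionForm_eq, torsionCoeff_shearForm_zero]

/-- Since the torsion vanishes at the origin, the derivative of the structure equations has the same
shape as the equations themselves, with `∂_d a_i` in place of `a_i` and Hessians of the `q_k` on the
other side. The same explicit inverse applies. -/
theorem fderiv_torsionCoeff_shearForm {H : Fin 3 → Matrix (Fin 4) (Fin 4) ℝ}
    (hH : ∀ k a d, H k a d = B k a d + B k d a) (d : Fin 4) :
    (fun i a => fderiv ℝ (torsionCoeff (shearForm B) i a) 0 (e d))
      = ![![(H 2 2 d - H 1 3 d) / 2, -H 0 1 d, -(H 1 1 d + H 0 2 d) / 2, -(H 2 1 d + H 0 3 d) / 2],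
        ![(H 0 3 d - H 2 1 d) / 2, -(H 1 1 d + H 0 2 d) / 2, -H 1 2 d, -(H 2 2 d + H 1 3 d) / 2],
        ![(H 1 1 d - H 0 2 d) / 2, -(H 2 1 d + H 0 3 d) / 2, -(H 2 2 d + H 1 3 d) / 2,
          -H 2 3 d]] := by
  have h := torsion_eq_of_structure_eq
    (x := fun i a => fderiv ℝ (torsionCoeff (shearForm B) i a) 0 (e d))
    (F := fun i a b c => ∑ k, shearMatrix i k b c * H k a d
      - ∑ k, shearMatrix i k a c * H k b d + ∑ k, shearMatrix i k a b * H k c d)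
    fun i a b c => by
      have := (isLocalSU2_shearForm B).pderiv_structure_eq (Set.mem_univ 0) i a b c d
      simp only [fderiv_fderiv_shearForm, torsionCoeff_shearForm_zero,
        formMatrixAt_shearForm_zero, ← hH] at this
      rw [this]
      ring
  rw [h]
  simp only [sum_shearMatrix_mul]
  funext i a
  fin_cases i <;> fin_cases a <;> simp [wedgeMatrix] <;> ring

/-- The connection terms multiply the torsion, which is zero at the origin. -/
theorem codiffTorsion_shearForm (i : Fin 3) :
    codiffTorsion (shearForm B) i 0
      = -∑ b, fderiv ℝ (torsionCoeff (shearForm B) i b) 0 (e b) := by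
  simp only [codiffTorsion, metricAt_shearForm_zero, inv_one, covDeriv, comp_torsionForm,
    torsionCoeff_shearForm_zero, mul_zero, Finset.sum_const_zero, sub_zero]
  simp [Matrix.one_apply]

theorem dTorsion_shearForm (i j : Fin 3) :
    dTorsion (shearForm B) i j 0
      = 1 / 2 * ((dTorsionMatrix (shearForm B) i 0)ᵀ * stdMatrix j).trace := by
  rw [(isLocalSU2_shearForm B).dTorsion_eq (Set.mem_univ 0), inner₂, metricAt_shearForm_zero,
    formMatrixAt_shearForm_zero]
  simp

end Shear

/-! ### Realising prescribed second-order terms -/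

/-- Coefficients of the quadratic polynomials that realise given second-order torsion terms. -/
noncomputable def realizingCoeff (d : Fin 3 → ℝ) (m : Matrix (Fin 3) (Fin 3) ℝ) :
    Fin 3 → Matrix (Fin 4) (Fin 4) ℝ :=
  -- The coefficients of `y_0 y_l` produce the `m i j`. The coefficient of `y_{k+1}²` in `q_k` then
  -- adjusts `δa_k` alone among the nine terms; the entry of `m` added to or subtracted from `d k`
  -- there cancels what the mixed coefficients contribute to `δa_k`.
  ![!![0, -m 0 0, -2 * m 0 1, -2 * m 0 2; 0, (d 0 + m 1 2) / 2, 0, 0; 0, 0, 0, 0; 0, 0, 0, 0],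
    !![0, 0, -m 1 1, -2 * m 1 2; 0, 0, 0, 0; 0, 0, (d 1 - m 0 2) / 2, 0; 0, 0, 0, 0],
    !![0, 0, 0, -m 2 2; 0, 0, 0, 0; 0, 0, 0, 0; 0, 0, 0, (d 2 + m 0 1) / 2]]

theorem fderiv_torsionCoeff_realizingCoeff (d : Fin 3 → ℝ) (m : Matrix (Fin 3) (Fin 3) ℝ)
    (c : Fin 4) (i : Fin 3) (a : Fin 4) :
    fderiv ℝ (torsionCoeff (shearForm (realizingCoeff d m)) i a) 0 (e c)
      = (let H := fun k => realizingCoeff d m k + (realizingCoeff d m k)ᵀ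
        ![![(H 2 2 c - H 1 3 c) / 2, -H 0 1 c, -(H 1 1 c + H 0 2 c) / 2, -(H 2 1 c + H 0 3 c) / 2],
        ![(H 0 3 c - H 2 1 c) / 2, -(H 1 1 c + H 0 2 c) / 2, -H 1 2 c, -(H 2 2 c + H 1 3 c) / 2],
        ![(H 1 1 c - H 0 2 c) / 2, -(H 2 1 c + H 0 3 c) / 2, -(H 2 2 c + H 1 3 c) / 2,
          -H 2 3 c]]) i a :=
  congrFun (congrFun (fderiv_torsionCoeff_shearForm (realizingCoeff d m) (fun _ _ _ => rfl) c) i) a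

theorem codiffTorsion_realizingCoeff (d : Fin 3 → ℝ) (m : Matrix (Fin 3) (Fin 3) ℝ) (i : Fin 3) :
    codiffTorsion (shearForm (realizingCoeff d m)) i 0 = d i := by
  rw [codiffTorsion_shearForm]
  simp only [fderiv_torsionCoeff_realizingCoeff]
  fin_cases i <;>
  · simp [Fin.sum_univ_four, realizingCoeff]
    try ring

theorem dTorsion_realizingCoeff (d : Fin 3 → ℝ) (m : Matrix (Fin 3) (Fin 3) ℝ) {i j : Fin 3}
    (hij : i ≤ j) : dTorsion (shearForm (realizingCoeff d m)) i j 0 = m i j := by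
  -- By self-duality, the trace against `stdMatrix j` involves only two of the six components of
  -- `X`.
  have h : ∀ X : Matrix (Fin 4) (Fin 4) ℝ, Xᵀ = -X → 1 / 2 * (Xᵀ * stdMatrix j).trace
      = ![X 0 1 + X 2 3, X 0 2 - X 1 3, X 0 3 + X 1 2] j := fun X hX => by
    rw [← wedge_stdMatrix hX]
    fin_cases j <;> simp [wedge, stdMatrix]
  rw [dTorsion_shearForm, h _ (dTorsionMatrix_transpose _ _ _)]
  simp only [dTorsionMatrix, Matrix.of_apply, fderiv_torsionCoeff_realizingCoeff]
  fin_cases i <;> fin_cases j <;> first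
    | exact absurd hij (by decide)
    | (simp [realizingCoeff]
       try ring)

end SU2

theorem mainTheorem12 :
    -- the three relations, on every 4-manifold, in every chart and at every point of it
    (∀ (M : Type*) [TopologicalSpace M] [ChartedSpace SU2.E4 M] [IsManifold (𝓡 4) ∞ M]
      (S : SU2.SU2Structure M), ∀ φ ∈ IsManifold.maximalAtlas (𝓡 4) ∞ M, ∀ y ∈ φ.target,
      SU2.dTorsion (S.inChart φ) 1 2 y = SU2.dTorsion (S.inChart φ) 2 1 y
        + SU2.quadTorsion (S.inChart φ) 0 1 1 y + SU2.quadTorsion (S.inChart φ) 0 2 2 y ∧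
      SU2.dTorsion (S.inChart φ) 2 0 y = SU2.dTorsion (S.inChart φ) 0 2 y
        + SU2.quadTorsion (S.inChart φ) 1 2 2 y + SU2.quadTorsion (S.inChart φ) 1 0 0 y ∧
      SU2.dTorsion (S.inChart φ) 0 1 y = SU2.dTorsion (S.inChart φ) 1 0 y
        + SU2.quadTorsion (S.inChart φ) 2 0 0 y + SU2.quadTorsion (S.inChart φ) 2 1 1 y) ∧
    -- the nine terms `δa_i` and `g(da_i, ω_j)`, `i ≤ j`, are independent, even modulo torsion:
    -- they take arbitrary values at a point where the torsion vanishes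
    (∀ (d : Fin 3 → ℝ) (m : Matrix (Fin 3) (Fin 3) ℝ),
      ∃ S : SU2.SU2Structure SU2.E4,
        (∀ i, SU2.torsionForm (S.inChart (OpenPartialHomeomorph.refl SU2.E4)) i 0 = 0) ∧
        (∀ i, SU2.codiffTorsion (S.inChart (OpenPartialHomeomorph.refl SU2.E4)) i 0 = d i) ∧
        (∀ i j, i ≤ j →
          SU2.dTorsion (S.inChart (OpenPartialHomeomorph.refl SU2.E4)) i j 0 = m i j)) := by
  refine ⟨fun M _ _ _ S φ hφ y hy => ?_, fun d m => ?_⟩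
  · have h := S.isLocalSU2_inChart hφ
    exact ⟨h.dTorsion_relation hy 0, h.dTorsion_relation hy 1, h.dTorsion_relation hy 2⟩
  · refine ⟨SU2.shearStructure (SU2.realizingCoeff d m), ?_⟩
    rw [SU2.shearStructure_inChart_refl]
    exact ⟨SU2.torsionForm_shearForm_zero _, SU2.codiffTorsion_realizingCoeff d m,
      fun i j hij => SU2.dTorsion_realizingCoeff d m hij⟩
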